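/- **Setting.** Let $n\ge 0$, $N\ge 1$ be integers, $\tilde M=\mathbb R^n\times T^n$ with $T^n=\mathbb R^n/\mathbb Z^n$, coordinates $(x,y)$ and symplectic form $\omega_0=\sum_i dx_i\wedge dy_i$, and let $\tilde L^{\otimes N}=\tilde M\times\mathbb C$ with the connection $\nabla=d-2\pi\sqrt{-1}\,N\,x\cdot dy$ and the standard Hermitian metric. Its sections are the smooth functions $s:\tilde M\to\mathbb C$. Let $Z=X+\sqrt{-1}\,Y$ be a smooth map from $\mathbb R^n$ to the Siegel upper half space (complex symmetric $n\times n$ matrices with positive definite imaginary part), regarded as a map on $\tilde M$ that does not depend on $y$, and let $J$ be the corresponding $\omega_0$-compatible almost complex structure $$J\begin{pmatrix}u_x\\u_y\end{pmatrix}=\begin{pmatrix}XY^{-1}&-Y-XY^{-1}X\\ Y^{-1}&-Y^{-1}X\end{pmatrix}\begin{pmatrix}u_x\\u_y\end{pmatrix}.$$ Put $g=\omega_0(\cdot,J\cdot)$ and $\Omega=(Y+XY^{-1}X)^{-1}ZY^{-1}$. Let $D$ be the Spin${}^c$ Dirac operator of $(\tilde M,N\omega_0,J)$ with coefficients in $\tilde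 L^{\otimes N}$; on a section $s$ of $\tilde L^{\otimes N}$ it is $$Ds=\sum_i\bigl\{f(dx_i)\otimes\nabla_{\partial_{x_i}}s+f(dy_i)\otimes\nabla_{\partial_{y_i}}s\bigr\},$$ a section of $(T\tilde M,J)\otimes_{\mathbb C}\tilde L^{\otimes N}$, where $f:T^*\tilde M\to T\tilde M$ is defined by $\tau=Ng(f(\tau),\cdot)$. Let a group $\Gamma$ act on $\tilde L^{\otimes N}\to\tilde M\to\mathbb R^n$ preserving $\omega_0$, $J$, $\nabla$ and the Hermitian metric, by $\rho_\gamma(x)=A_\gamma x+c_\gamma$, $\tilde\rho_\gamma(x,y)=(\rho_\gamma(x),{}^tA_\gamma^{-1}y+u_\gamma(x))$ and $$(x,y,z)\mapsto\bigl(\tilde\rho_\gamma(x,y),\,e_\gamma(x,y)z\bigr),\qquad e_\gamma(x,y)=g_\gamma e^{2\pi\sqrt{-1}N\{\tilde g_\gamma(x)+c_\gamma\cdot({}^tA_\gamma^{-1}y)\}},$$ with $A_\gamma\in GL_n(\mathbb Z)$, $c_\gamma\in\frac1N\mathbb Z^n$, $g_\gamma\in U(1)$, a smooth map $u_\gamma:\mathbb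 R^n\to T^n$ (also denoting a smooth lift $\mathbb R^n\to\mathbb R^n$), and $$\tilde g_\gamma(x)=\rho_\gamma(x)\cdot u_\gamma(x)-c_\gamma\cdot u_\gamma(0)-\sum_{i=1}^n\int_0^{x_i}\bigl({}^tA_\gamma u_\gamma(0,\dots,0,t,x_{i+1},\dots,x_n)\bigr)_i\,dt .$$ Assume that $\rho$ is properly discontinuous and free, and let $F\subset\mathbb R^n$ be a fundamental domain: each $\rho$-orbit meets $F$ in exactly one point. A section $s$ is $\Gamma$-equivariant if $e_\gamma\cdot s=s\circ\tilde\rho_\gamma$ for all $\gamma\in\Gamma$. For $m\in\mathbb Z^n$ let $(\mathrm C_m)$ denote the commutativity condition $$\bigl((\partial_{x_i}\Omega)_x(m-Nx)\bigr)_j=\bigl((\partial_{x_j}\Omega)_x(m-Nx)\bigr)_i\quad\text{for all }i,j\text{ and all }x\in\mathbb R^n .$$ Put $$a_m(x)=\exp\Bigl(-2\pi\sqrt{-1}\sum_{i=1}^n\int_{m_i/N}^{x_i}\bigl(\Omega_p(m-Np)\bigr)_i\Big|_{p=(\frac{m_1}N,\dots,\frac{m_{i-1}}N,t,x_{i+1},\dots,x_n)}dt\Bigr),$$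 define $a_{N\rho_\gamma(m/N)}$ by $$a_{N\rho_\gamma(m/N)}(\rho_\gamma(x))=g_\gamma\,a_m(x)\,e^{2\pi\sqrt{-1}N\{\tilde g_\gamma(x)-\rho_\gamma(m/N)\cdot u_\gamma(x)\}},$$ and let $$\vartheta_{\frac mN}(x,y)=\sum_{\gamma\in\Gamma}a_{N\rho_\gamma(m/N)}(x)\,e^{2\pi\sqrt{-1}N\rho_\gamma(m/N)\cdot y}.$$ Throughout, "converges absolutely and uniformly" means: absolutely, and uniformly on every compact set. **Theorem.** 1. If there is a section $s\neq0$ of $\tilde L^{\otimes N}$ that is $\Gamma$-equivariant and satisfies $Ds=0$, then $(\mathrm C_m)$ holds for some $m\in\mathbb Z^n$ with $\frac mN\in F$. 2. Conversely, if $\frac mN\in F\cap\frac1N\mathbb Z^n$ satisfies $(\mathrm C_m)$ and $\vartheta_{\frac mN}$ converges absolutely and uniformly, then $\vartheta_{\frac mN}$ is a smooth, $\Gamma$-equivariant, non-zero section with $D\vartheta_{\frac mN}=0$. 3. Suppose that $J$ is integrable (its Nijenhuis tensor vanishes) and that $\vartheta_{\frac mN}$ converges absolutely and uniformly for every $\frac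 mN\in F\cap\frac1N\mathbb Z^n$. Let $H$ be the space of $\Gamma$-equivariant holomorphic sections of $\tilde L^{\otimes N}\to(\tilde M,N\omega_0,J)$, i.e. of $\Gamma$-equivariant sections with $\nabla_{v+\sqrt{-1}Jv}s=0$ for all tangent vectors $v$. Then the $\vartheta_{\frac mN}$, $\frac mN\in F\cap\frac1N\mathbb Z^n$, are linearly independent elements of $H$, and they form a basis of $H$ in the following sense: every $s\in H$ can be written in exactly one way as $s=\sum_{\frac mN\in F\cap\frac1N\mathbb Z^n}\alpha_m\vartheta_{\frac mN}$, $\alpha_m\in\mathbb C$, with a series that converges absolutely and uniformly. If $F\cap\frac1N\mathbb Z^n$ is finite (for instance, if $\rho$ is cocompact), they form a basis of the complex vector space $H$. -/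

import Mathlib

open scoped ContDiff Matrix

noncomputable section

namespace EquivQuant

/-! ### The space `ℝⁿ × Tⁿ`

Points of `ℝⁿ × Tⁿ`, `Tⁿ = ℝⁿ / ℤⁿ`, are represented by points `(x, y)` of `ℝⁿ × ℝⁿ`, with `y`
taken modulo `ℤⁿ`. Objects on `ℝⁿ × Tⁿ` are the `ℤⁿ`-periodic (in `y`) objects on `ℝⁿ × ℝⁿ`.
Tangent vectors `u = ∑ᵢ (u_x)ᵢ ∂_{xᵢ} + (u_y)ᵢ ∂_{yᵢ}` are the pairs `(u_x, u_y)`. -/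

/-- `ℝⁿ × ℝⁿ`, the universal covering of `ℝⁿ × Tⁿ`, and also its tangent space at any point. -/
abbrev Cov (n : ℕ) : Type := (Fin n → ℝ) × (Fin n → ℝ)

/-- The integer vector `k` as a real vector. -/
def intVec {n : ℕ} (k : Fin n → ℤ) : Fin n → ℝ := fun i => (k i : ℝ)

/-- The point `m / N`. -/
def bsPoint {n : ℕ} (N : ℕ) (m : Fin n → ℤ) : Fin n → ℝ := fun i => (m i : ℝ) / (N : ℝ)

/-- `f` is `ℤⁿ`-periodic in `y`, i.e. it descends to `ℝⁿ × Tⁿ`. -/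
def PeriodicInFibre {n : ℕ} {α : Type*} (f : Cov n → α) : Prop :=
  ∀ (p : Cov n) (k : Fin n → ℤ), f (p.1, p.2 + intVec k) = f p

/-- `p` and `q` represent the same point of `ℝⁿ × Tⁿ`. -/
def SamePoint {n : ℕ} (p q : Cov n) : Prop :=
  q.1 = p.1 ∧ ∃ k : Fin n → ℤ, q.2 = p.2 + intVec k

/-- Smooth sections of the trivial line bundle `(ℝⁿ × Tⁿ) × ℂ` (which underlies `L^{⊗N}`). -/
def IsSection {n : ℕ} (s : Cov n → ℂ) : Prop := ContDiff ℝ ∞ s ∧ PeriodicInFibre s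

/-- The symplectic form `ω₀ = ∑ dxᵢ ∧ dyᵢ`. -/
def omega0 (n : ℕ) : Cov n →ₗ[ℝ] Cov n →ₗ[ℝ] ℝ :=
  LinearMap.mk₂ ℝ (fun u v => u.1 ⬝ᵥ v.2 - u.2 ⬝ᵥ v.1)
    (fun u u' v => by simp only [Prod.fst_add, Prod.snd_add, add_dotProduct]; ring)
    (fun a u v => by simp only [Prod.smul_fst, Prod.smul_snd, smul_dotProduct, smul_eq_mul]; ring)
    (fun u v v' => by simp only [Prod.fst_add, Prod.snd_add, dotProduct_add]; ring)
    (fun a u v => by simp only [Prod.smul_fst, Prod.smul_snd, dotProduct_smul, smul_eq_mul]; ring)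

/-- The connection `∇ = d - 2π√-1 N x·dy` of `L^{⊗N}`: the derivative `∇_v s` at `p`. -/
def nabla {n : ℕ} (N : ℕ) (s : Cov n → ℂ) (p v : Cov n) : ℂ :=
  fderiv ℝ s p v - 2 * Real.pi * Complex.I * N * ((p.1 ⬝ᵥ v.2 : ℝ) : ℂ) * s p

/-! ### Compatible almost complex structures -/

/-- The Siegel upper half space. -/
def Siegel (n : ℕ) : Set (Matrix (Fin n) (Fin n) ℂ) :=
  {Z | Zᵀ = Z ∧ (Z.map Complex.im).PosDef}

/-- The real part `X` of `Z = X + √-1 Y`. -/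
def reM {n : ℕ} (Z : Siegel n) : Matrix (Fin n) (Fin n) ℝ := Z.1.map Complex.re

/-- The imaginary part `Y` of `Z = X + √-1 Y`. -/
def imM {n : ℕ} (Z : Siegel n) : Matrix (Fin n) (Fin n) ℝ := Z.1.map Complex.im

/-- Smooth maps `ℝⁿ → 𝒮ₙ`; these are the smooth maps `ℝⁿ × Tⁿ → 𝒮ₙ` that do not depend on `y`. -/
def SmoothSiegel {n : ℕ} (Z : (Fin n → ℝ) → Siegel n) : Prop :=
  ∀ i j, ContDiff ℝ ∞ (fun x => (Z x).1 i j)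

/-- The complex structure on the tangent space given by `Z = X + √-1 Y`:
`J (u_x, u_y) = (XY⁻¹ u_x - (Y + XY⁻¹X) u_y, Y⁻¹ u_x - Y⁻¹X u_y)`. -/
def cplxJ {n : ℕ} (Z : Siegel n) : Cov n →ₗ[ℝ] Cov n :=
  LinearMap.prod
    ((reM Z * (imM Z)⁻¹).mulVecLin ∘ₗ LinearMap.fst ℝ _ _
      - (imM Z + reM Z * (imM Z)⁻¹ * reM Z).mulVecLin ∘ₗ LinearMap.snd ℝ _ _)
    ((imM Z)⁻¹.mulVecLin ∘ₗ LinearMap.fst ℝ _ _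
      - ((imM Z)⁻¹ * reM Z).mulVecLin ∘ₗ LinearMap.snd ℝ _ _)

theorem cplxJ_cplxJ {n : ℕ} (Z : Siegel n) (u : Cov n) : cplxJ Z (cplxJ Z u) = -u := by
  have hu : IsUnit (imM Z).det := (Matrix.isUnit_iff_isUnit_det _).1 Z.2.2.isUnit
  have h1 : imM Z * (imM Z)⁻¹ = 1 := Matrix.mul_nonsing_inv _ hu
  have h2 : (imM Z)⁻¹ * imM Z = 1 := Matrix.nonsing_inv_mul _ hu
  generalize hY : imM Z = Y at *
  generalize hW : Y⁻¹ = W at *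
  have hJ : ∀ v : Cov n, cplxJ Z v =
      ((reM Z * W) *ᵥ v.1 - (Y + reM Z * W * reM Z) *ᵥ v.2,
        W *ᵥ v.1 - (W * reM Z) *ᵥ v.2) := by
    intro v
    simp only [cplxJ, hY, hW]
    rfl
  generalize reM Z = X at *
  rw [hJ, hJ]
  have e1 : X * W * (X * W) - (Y + X * W * X) * W = -1 := by
    rw [add_mul, h1]; noncomm_ring
  have e2 : X * W * (Y + X * W * X) - (Y + X * W * X) * (W * X) = 0 := by
    have : X * W * Y = X := by rw [mul_assoc, h2, mul_one]
    have h3 : Y * (W * X) = X := by rw [← mul_assoc, h1, one_mul]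
    rw [mul_add, add_mul, this, h3]; noncomm_ring
  have e3 : W * (X * W) - W * X * W = 0 := by noncomm_ring
  have e4 : W * (Y + X * W * X) - W * X * (W * X) = 1 := by
    rw [mul_add, h2]; noncomm_ring
  refine Prod.ext ?_ ?_
  · have : (X * W) *ᵥ ((X * W) *ᵥ u.1 - (Y + X * W * X) *ᵥ u.2)
        - (Y + X * W * X) *ᵥ (W *ᵥ u.1 - (W * X) *ᵥ u.2)
        = (X * W * (X * W) - (Y + X * W * X) * W) *ᵥ u.1
          - (X * W * (Y + X * W * X) - (Y + X * W * X) * (W * X)) *ᵥ u.2 := by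
      simp only [Matrix.mulVec_sub, Matrix.sub_mulVec, Matrix.mulVec_mulVec]; abel
    simp [this, e1, e2, Matrix.neg_mulVec]
  · have : W *ᵥ ((X * W) *ᵥ u.1 - (Y + X * W * X) *ᵥ u.2)
        - (W * X) *ᵥ (W *ᵥ u.1 - (W * X) *ᵥ u.2)
        = (W * (X * W) - W * X * W) *ᵥ u.1
          - (W * (Y + X * W * X) - W * X * (W * X)) *ᵥ u.2 := by
      simp only [Matrix.mulVec_sub, Matrix.sub_mulVec, Matrix.mulVec_mulVec]; abel
    simp [this, e3, e4]

/-- `J_Z` is integrable: its Nijenhuis tensor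
`[JU, JV] - J[JU, V] - J[U, JV] - [U, V]` vanishes for all smooth vector fields on `ℝⁿ × Tⁿ`. -/
def IsIntegrable {n : ℕ} (Z : (Fin n → ℝ) → Siegel n) : Prop :=
  ∀ U V : Cov n → Cov n, ContDiff ℝ ∞ U → PeriodicInFibre U → ContDiff ℝ ∞ V → PeriodicInFibre V →
    ∀ p : Cov n,
      VectorField.lieBracket ℝ (fun q => cplxJ (Z q.1) (U q)) (fun q => cplxJ (Z q.1) (V q)) p
        - cplxJ (Z p.1) (VectorField.lieBracket ℝ (fun q => cplxJ (Z q.1) (U q)) V p)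
        - cplxJ (Z p.1) (VectorField.lieBracket ℝ U (fun q => cplxJ (Z q.1) (V q)) p)
        - VectorField.lieBracket ℝ U V p = 0

/-! ### The Spin^c Dirac operator on degree-zero spinors -/

/-- The isomorphism `T → T*`, `u ↦ N g(u, ·)`, with `g(u, v) = ω₀(u, J v)`. -/
def flat {n : ℕ} (N : ℕ) (Z : Siegel n) : Cov n →ₗ[ℝ] Module.Dual ℝ (Cov n) :=
  (N : ℝ) • (omega0 n).compl₂ (cplxJ Z)

theorem flat_apply {n : ℕ} (N : ℕ) (Z : Siegel n) (u v : Cov n) :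
    flat N Z u v = N * omega0 n u (cplxJ Z v) := rfl

theorem flat_bijective {n : ℕ} {N : ℕ} (hN : 0 < N) (Z : Siegel n) :
    Function.Bijective (flat N Z) := by
  have hinj : Function.Injective (flat N Z) := by
    rw [injective_iff_map_eq_zero]
    intro u hu
    have h : ∀ w, omega0 n u w = 0 := by
      intro w
      have h1 := congrArg (fun φ => φ (-(cplxJ Z w))) hu
      have hN' : (N : ℝ) ≠ 0 := by exact_mod_cast hN.ne'
      simpa [flat_apply, cplxJ_cplxJ, hN'] using h1
    have h1 : u.1 = 0 := by
      have := h (0, u.1)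
      simpa [omega0] using this
    have h2 : u.2 = 0 := by
      have := h (u.2, 0)
      simpa [omega0] using this
    exact Prod.ext h1 h2
  exact ⟨hinj, (LinearMap.injective_iff_surjective_of_finrank_eq_finrank
    (Subspace.dual_finrank_eq (K := ℝ) (V := Cov n)).symm).1 hinj⟩

/-- The isomorphism `f : T* → T` with `τ = N g(f τ, ·)`. -/
def sharp {n : ℕ} {N : ℕ} (hN : 0 < N) (Z : Siegel n) : Module.Dual ℝ (Cov n) ≃ₗ[ℝ] Cov n :=
  (LinearEquiv.ofBijective (flat N Z) (flat_bijective hN Z)).symm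

/-- Clifford multiplication `c(u) z = u ∧ z - u ⌟ z = u ⊗ z` on degree-zero elements `z` of
`⋀(T, J) ⊗ L^{⊗N}`. The value lies in the degree-one part `(T, J) ⊗_ℂ ℂ`, which is identified with
`(T, J)` through `u ⊗ (a + b√-1) = a u + b J u`. -/
def clifford {n : ℕ} (Z : Siegel n) (u : Cov n) (z : ℂ) : Cov n :=
  z.re • u + z.im • cplxJ Z u

/-- The coordinate covector `dxᵢ`. -/
def dx {n : ℕ} (i : Fin n) : Module.Dual ℝ (Cov n) := LinearMap.proj i ∘ₗ LinearMap.fst ℝ _ _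

/-- The coordinate covector `dyᵢ`. -/
def dy {n : ℕ} (i : Fin n) : Module.Dual ℝ (Cov n) := LinearMap.proj i ∘ₗ LinearMap.snd ℝ _ _

/-- The coordinate vector `∂_{xᵢ}`. -/
def ddx {n : ℕ} (i : Fin n) : Cov n := (Pi.single i 1, 0)

/-- The coordinate vector `∂_{yᵢ}`. -/
def ddy {n : ℕ} (i : Fin n) : Cov n := (0, Pi.single i 1)

/-- The Spin^c Dirac operator `D = c ∘ (f ⊗ id) ∘ ∇` on sections `s` of `L^{⊗N}`, i.e. in degree
zero: `D s = ∑ᵢ c(f(dxᵢ)) ∇_{∂_{xᵢ}} s + c(f(dyᵢ)) ∇_{∂_{yᵢ}} s`, a section of `(T, J) ⊗ L^{⊗N}`. -/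
def dirac {n : ℕ} {N : ℕ} (hN : 0 < N) (Z : (Fin n → ℝ) → Siegel n) (s : Cov n → ℂ)
    (p : Cov n) : Cov n :=
  ∑ i, (clifford (Z p.1) (sharp hN (Z p.1) (dx i)) (nabla N s p (ddx i))
    + clifford (Z p.1) (sharp hN (Z p.1) (dy i)) (nabla N s p (ddy i)))

/-- `s` is holomorphic for the holomorphic structure on `L^{⊗N}` with `∂̄ = ∇^{0,1}`:
`∇_{v + √-1 J v} s = 0` for all tangent vectors `v`. -/
def IsHolomorphic {n : ℕ} (N : ℕ) (Z : (Fin n → ℝ) → Siegel n) (s : Cov n → ℂ) : Prop :=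
  ∀ p v : Cov n, nabla N s p v + Complex.I * nabla N s p (cplxJ (Z p.1) v) = 0

/-! ### The commutativity condition and the functions `a_m` -/

/-- `Ω = (Y + XY⁻¹X)⁻¹ Z Y⁻¹`. -/
def OmegaM {n : ℕ} (Z : Siegel n) : Matrix (Fin n) (Fin n) ℂ :=
  ((imM Z + reM Z * (imM Z)⁻¹ * reM Z)⁻¹).map Complex.ofReal * Z.1
    * ((imM Z)⁻¹).map Complex.ofReal

/-- `((∂_{xᵢ}Ω)_x (m - N x))_j = ((∂_{xⱼ}Ω)_x (m - N x))_i` for all `i`, `j` and all `x`. -/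
def Commutativity {n : ℕ} (N : ℕ) (Z : (Fin n → ℝ) → Siegel n) (m : Fin n → ℤ) : Prop :=
  ∀ (i j : Fin n) (x : Fin n → ℝ),
    ∑ k, fderiv ℝ (fun x' => OmegaM (Z x') j k) x (Pi.single i 1) * ((m k : ℂ) - N * (x k : ℂ))
      = ∑ k, fderiv ℝ (fun x' => OmegaM (Z x') i k) x (Pi.single j 1)
          * ((m k : ℂ) - N * (x k : ℂ))

/-- The point `(b₁, …, b_{i-1}, t, x_{i+1}, …, xₙ)`. -/
def stair {n : ℕ} (b x : Fin n → ℝ) (i : Fin n) (t : ℝ) : Fin n → ℝ :=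
  fun k => if k < i then b k else if k = i then t else x k

/-- `a_m(x) = exp(-2π√-1 ∑ᵢ Gᵢ)`, where `Gᵢ` is the integral of `(Ω(m - N x))ᵢ` over the segment
from `(m₁/N, …, m_{i-1}/N, mᵢ/N, x_{i+1}, …, xₙ)` to `(m₁/N, …, m_{i-1}/N, xᵢ, x_{i+1}, …, xₙ)`. -/
def aSol {n : ℕ} (N : ℕ) (Z : (Fin n → ℝ) → Siegel n) (m : Fin n → ℤ) (x : Fin n → ℝ) : ℂ :=
  Complex.exp (-(2 * Real.pi * Complex.I) *
    ∑ i, ∫ t in (bsPoint N m i)..(x i),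
      ∑ k, OmegaM (Z (stair (bsPoint N m) x i t)) i k
        * ((m k : ℂ) - N * (stair (bsPoint N m) x i t k : ℂ)))

/-! ### The `Γ`-action -/

/-- The data of the maps `ρ_γ`, `ρ̃_γ` and of their lifts to `L^{⊗N}`. Here `u γ : ℝⁿ → ℝⁿ` is a
lift of the map `u_γ : ℝⁿ → Tⁿ`. -/
structure ActionData (n : ℕ) (Γ : Type*) where
  A : Γ → Matrix.GeneralLinearGroup (Fin n) ℤ
  c : Γ → Fin n → ℝ
  u : Γ → (Fin n → ℝ) → (Fin n → ℝ)
  g : Γ → Circle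

namespace ActionData

variable {n : ℕ} {Γ : Type*} (d : ActionData n Γ)

/-- `A_γ` as a real matrix. -/
def AR (γ : Γ) : Matrix (Fin n) (Fin n) ℝ := ((d.A γ).1).map (fun a : ℤ => (a : ℝ))

/-- `ᵗA_γ⁻¹` as a real matrix. -/
def AinvT (γ : Γ) : Matrix (Fin n) (Fin n) ℝ := ((((d.A γ)⁻¹).1).map (fun a : ℤ => (a : ℝ)))ᵀ

/-- `ρ_γ(x) = A_γ x + c_γ`. -/
def rho (γ : Γ) (x : Fin n → ℝ) : Fin n → ℝ := d.AR γ *ᵥ x + d.c γ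

/-- `ρ̃_γ(x, y) = (A_γ x + c_γ, ᵗA_γ⁻¹ y + u_γ(x))`. -/
def rhoT (γ : Γ) (p : Cov n) : Cov n := (d.rho γ p.1, d.AinvT γ *ᵥ p.2 + d.u γ p.1)

/-- `g̃_γ(x) = ρ_γ(x)·u_γ(x) - c_γ·u_γ(0) - ∑ᵢ F_γ^i(0, …, 0, xᵢ, …, xₙ)`, where
`F_γ^i(x) = ∫₀^{xᵢ} (ᵗA_γ u_γ(x))ᵢ dxᵢ`. -/
def gT (γ : Γ) (x : Fin n → ℝ) : ℝ :=
  d.rho γ x ⬝ᵥ d.u γ x - d.c γ ⬝ᵥ d.u γ 0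
    - ∑ i, ∫ t in (0 : ℝ)..(x i), ((d.AR γ)ᵀ *ᵥ d.u γ (stair 0 x i t)) i

/-- The factor by which the lift of `ρ̃_γ` to `L^{⊗N}` multiplies the fibre over `(x, y)`:
`g_γ exp(2π√-1 N (g̃_γ(x) + c_γ·(ᵗA_γ⁻¹ y)))`. -/
def factor (N : ℕ) (γ : Γ) (p : Cov n) : ℂ :=
  (d.g γ : ℂ) * Complex.exp (2 * Real.pi * Complex.I * N *
    ((d.gT γ p.1 + d.c γ ⬝ᵥ (d.AinvT γ *ᵥ p.2) : ℝ) : ℂ))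

/-- The maps `(x, y, z) ↦ (ρ̃_γ(x, y), factor_γ(x, y) z)` are an action of the group `Γ` on
`L^{⊗N} → (ℝⁿ × Tⁿ, N ω₀, J_Z)` which preserves all the data. (The lifts given by `factor`
preserve the connection and the Hermitian metric by their very form.) -/
structure IsQuantumAction [Group Γ] (N : ℕ) (Z : (Fin n → ℝ) → Siegel n) : Prop where
  smooth : ∀ γ, ContDiff ℝ ∞ (d.u γ)
  bohrSommerfeld : ∀ γ, ∃ k : Fin n → ℤ, d.c γ = bsPoint N k
  one_act : ∀ p, SamePoint (d.rhoT 1 p) p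
  mul_act : ∀ γ₁ γ₂ p, SamePoint (d.rhoT (γ₁ * γ₂) p) (d.rhoT γ₁ (d.rhoT γ₂ p))
  factor_one : ∀ p, d.factor N 1 p = 1
  factor_mul : ∀ γ₁ γ₂ p,
    d.factor N (γ₁ * γ₂) p = d.factor N γ₁ (d.rhoT γ₂ p) * d.factor N γ₂ p
  symplectic : ∀ γ (p v w : Cov n),
    omega0 n (fderiv ℝ (d.rhoT γ) p v) (fderiv ℝ (d.rhoT γ) p w) = omega0 n v w
  complex : ∀ γ (p v : Cov n),
    fderiv ℝ (d.rhoT γ) p (cplxJ (Z p.1) v) = cplxJ (Z (d.rho γ p.1)) (fderiv ℝ (d.rhoT γ) p v)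

/-- The action `ρ` on `ℝⁿ` is free. -/
def IsFree [Group Γ] : Prop := ∀ γ x, d.rho γ x = x → γ = 1

/-- The action `ρ` on `ℝⁿ` is properly discontinuous. -/
def IsProperlyDiscontinuous : Prop :=
  ∀ K : Set (Fin n → ℝ), IsCompact K → {γ | (d.rho γ '' K ∩ K).Nonempty}.Finite

/-- `F` is a fundamental domain of `ρ`: every orbit meets `F` in exactly one point. -/
def IsFundamentalDomain (F : Set (Fin n → ℝ)) : Prop :=
  ∀ x, ∃! z, z ∈ F ∧ ∃ γ, d.rho γ z = x

/-- The section `s` is `Γ`-equivariant. -/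
def IsEquivariant (N : ℕ) (s : Cov n → ℂ) : Prop :=
  ∀ γ p, d.factor N γ p * s p = s (d.rhoT γ p)

/-- The function `a_{Nρ_γ(m/N)}` with
`a_{Nρ_γ(m/N)}(ρ_γ(x)) = g_γ a_m(x) exp(2π√-1 N (g̃_γ(x) - ρ_γ(m/N)·u_γ(x)))`. -/
def aTrans [Group Γ] (N : ℕ) (Z : (Fin n → ℝ) → Siegel n) (m : Fin n → ℤ) (γ : Γ)
    (x : Fin n → ℝ) : ℂ :=
  (d.g γ : ℂ) * aSol N Z m (d.rho γ⁻¹ x) * Complex.exp (2 * Real.pi * Complex.I * N *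
    ((d.gT γ (d.rho γ⁻¹ x) - d.rho γ (bsPoint N m) ⬝ᵥ d.u γ (d.rho γ⁻¹ x) : ℝ) : ℂ))

/-- The term `a_{Nρ_γ(m/N)}(x) exp(2π√-1 N ρ_γ(m/N)·y)` of the series `ϑ_{m/N}`. -/
def thetaTerm [Group Γ] (N : ℕ) (Z : (Fin n → ℝ) → Siegel n) (m : Fin n → ℤ) (γ : Γ)
    (p : Cov n) : ℂ :=
  d.aTrans N Z m γ p.1 * Complex.exp (2 * Real.pi * Complex.I * N *
    ((d.rho γ (bsPoint N m) ⬝ᵥ p.2 : ℝ) : ℂ))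

/-- `ϑ_{m/N}(x, y) = ∑_{γ ∈ Γ} a_{Nρ_γ(m/N)}(x) exp(2π√-1 N ρ_γ(m/N)·y)`. -/
def theta [Group Γ] (N : ℕ) (Z : (Fin n → ℝ) → Siegel n) (m : Fin n → ℤ) (p : Cov n) : ℂ :=
  ∑' γ : Γ, d.thetaTerm N Z m γ p

/-- The complex vector space of `Γ`-equivariant holomorphic sections of `L^{⊗N}`. -/
def holSections (N : ℕ) (Z : (Fin n → ℝ) → Siegel n) : Submodule ℂ (Cov n → ℂ) where
  carrier := {s | IsSection s ∧ IsHolomorphic N Z s ∧ d.IsEquivariant N s}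
  zero_mem' := by
    refine ⟨⟨contDiff_const, fun _ _ => rfl⟩, fun p v => ?_, fun γ p => by simp⟩
    have h0 : fderiv ℝ (0 : Cov n → ℂ) p = 0 := fderiv_const_apply (0 : ℂ)
    simp [nabla, h0]
  add_mem' := by
    rintro s t ⟨hs, hs', hs''⟩ ⟨ht, ht', ht''⟩
    refine ⟨⟨hs.1.add ht.1, fun p k => ?_⟩, fun p v => ?_, fun γ p => ?_⟩
    · simp only [Pi.add_apply, hs.2 p k, ht.2 p k]
    · have h : fderiv ℝ (s + t) p = fderiv ℝ s p + fderiv ℝ t p :=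
        fderiv_add (hs.1.differentiable (by simp) p) (ht.1.differentiable (by simp) p)
      have e : ∀ w, nabla N (s + t) p w = nabla N s p w + nabla N t p w := by
        intro w
        simp only [nabla, h, Pi.add_apply, add_apply]; ring
      rw [e, e]
      linear_combination hs' p v + ht' p v
    · simp only [Pi.add_apply, mul_add, hs'' γ p, ht'' γ p]
  smul_mem' := by
    rintro a s ⟨hs, hs', hs''⟩
    refine ⟨⟨hs.1.const_smul a, fun p k => ?_⟩, fun p v => ?_, fun γ p => ?_⟩
    · simp only [Pi.smul_apply, hs.2 p k]
    · have h : fderiv ℝ (a • s) p = a • fderiv ℝ s p :=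
        fderiv_const_smul (hs.1.differentiable (by simp) p) a
      have e : ∀ w, nabla N (a • s) p w = a * nabla N s p w := by
        intro w
        simp only [nabla, h, Pi.smul_apply, smul_apply, smul_eq_mul]; ring
      rw [e, e]
      linear_combination a * hs' p v
    · simp only [Pi.smul_apply, smul_eq_mul, ← hs'' γ p]; ring

end ActionData

/-- The series `∑ᵢ fᵢ` of functions converges absolutely, and uniformly on compact sets. -/
def ConvergesAbsUnif {n : ℕ} {ι : Type*} (f : ι → Cov n → ℂ) : Prop :=
  (∀ p, Summable fun i => ‖f i p‖) ∧
    ∀ K : Set (Cov n), IsCompact K →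
      TendstoUniformlyOn (fun (S : Finset ι) p => ∑ i ∈ S, f i p) (fun p => ∑' i, f i p)
        Filter.atTop K

/-- The index set: the `m ∈ ℤⁿ` with `m/N ∈ F`, i.e. the Bohr–Sommerfeld points in `F`. -/
abbrev BSIndex {n : ℕ} (N : ℕ) (F : Set (Fin n → ℝ)) : Type :=
  {m : Fin n → ℤ // bsPoint N m ∈ F}

end EquivQuant

end

open EquivQuant

/-! For every tangent vector of the form `(v, Re Ω v)` the structure `J` returns the vertical vector
`(0, Im Ω v)`, so the vectors of type (0,1) are spanned by `∂_{xⱼ} + ∑ᵢ Ωᵢⱼ ∂_{yᵢ}`. The equation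
`Ds = 0` is the vanishing of `∇` along them (`dirac_eq_zero_iff`, `isHolomorphic_iff`). Neither `Ω`
nor the connection form depends on `y`, hence every Fourier component of a solution in the fibre
direction is again a solution (`isMode_component`).

A solution `f` of weight `k` ("mode") satisfies the total differential equation `df = f λ_k` with
`λ_k = 2π√-1 (k·dy - Ω(k - Nx)·dx)`. Hence it vanishes nowhere or identically, and is unique up to a
scalar. A non-zero one exists exactly when `λ_k` is closed, and this is (C_k), because the terms
coming from the derivative of `k - Nx` are symmetric (`commutativity_iff`, `IsMode.commutativity`,
`isMode_baseMode`). An integrable `J` makes `Ω(k - Nx)·dx` closed for every `k`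
(`IsIntegrable.fderiv_OmegaM_symm`).

The lift of `γ` preserves `∇` and `J`, so it carries modes of weight `k` to modes of weight
`Nρ_γ(k/N)` (`isMode_transport`), and `ϑ_{m/N}` is the sum of the translates of one mode. Since `ρ`
is free, the weights correspond bijectively to pairs of a point of `F ∩ (1/N)ℤⁿ` and an element of
`Γ` (`weight_bijective`). An equivariant section is thus determined by its components with weight in
`F`, and each of these is a multiple of the leading term of one theta series. This gives
non-vanishing, uniqueness and the expansion.

The analytic input is `exists_decay`: positivity of `Im Ω` forces a mode bounded by `B` on a ball to
be `O(B exp(-c‖k‖))` on a smaller ball, uniformly in `k`. Together with the fact that the terms of a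
locally uniform limit are its Fourier components, hence locally bounded by it, this allows termwise
differentiation and rearrangement of all the series involved. -/

noncomputable section

namespace EquivQuant

/-! ### The matrix `Ω` -/

/-- `W = Y + XY⁻¹X`. -/
def wM {n : ℕ} (Z : Siegel n) : Matrix (Fin n) (Fin n) ℝ :=
  imM Z + reM Z * (imM Z)⁻¹ * reM Z

theorem imM_posDef {n : ℕ} (Z : Siegel n) : (imM Z).PosDef := Z.2.2

theorem reM_transpose {n : ℕ} (Z : Siegel n) : (reM Z)ᵀ = reM Z := by
  rw [reM, ← Matrix.transpose_map, Z.2.1]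

theorem imM_transpose {n : ℕ} (Z : Siegel n) : (imM Z)ᵀ = imM Z := by
  rw [imM, ← Matrix.transpose_map, Z.2.1]

theorem wM_posDef {n : ℕ} (Z : Siegel n) : (wM Z).PosDef := by
  refine (imM_posDef Z).add_posSemidef ?_
  have h := (imM_posDef Z).inv.posSemidef.conjTranspose_mul_mul_same (reM Z)
  rwa [Matrix.conjTranspose_eq_transpose_of_trivial, reM_transpose] at h

theorem imM_det {n : ℕ} (Z : Siegel n) : IsUnit (imM Z).det :=
  (Matrix.isUnit_iff_isUnit_det _).1 (imM_posDef Z).isUnit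

theorem wM_det {n : ℕ} (Z : Siegel n) : IsUnit (wM Z).det :=
  (Matrix.isUnit_iff_isUnit_det _).1 (wM_posDef Z).isUnit

/-- The real part of `Ω`. -/
def omRe {n : ℕ} (Z : Siegel n) : Matrix (Fin n) (Fin n) ℝ := (wM Z)⁻¹ * reM Z * (imM Z)⁻¹

/-- The imaginary part of `Ω`. -/
def omIm {n : ℕ} (Z : Siegel n) : Matrix (Fin n) (Fin n) ℝ := (wM Z)⁻¹

theorem omIm_posDef {n : ℕ} (Z : Siegel n) : (omIm Z).PosDef := (wM_posDef Z).inv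

theorem coe_eq_reM_add {n : ℕ} (Z : Siegel n) :
    Z.1 = (reM Z).map Complex.ofRealHom + Complex.I • (imM Z).map Complex.ofRealHom := by
  ext i j
  simp [reM, imM, mul_comm Complex.I, Complex.re_add_im]

/-- `Z Y⁻¹ = X Y⁻¹ + √-1`, so the imaginary part of `Ω` is just `W⁻¹`, which is positive definite.
-/
theorem OmegaM_eq {n : ℕ} (Z : Siegel n) :
    OmegaM Z = (omRe Z).map Complex.ofRealHom + Complex.I • (omIm Z).map Complex.ofRealHom := by
  have h : (imM Z).map Complex.ofRealHom * (imM Z)⁻¹.map Complex.ofRealHom = 1 := by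
    rw [← Matrix.map_mul, Matrix.mul_nonsing_inv _ (imM_det Z)]; simp
  have e : OmegaM Z = (wM Z)⁻¹.map Complex.ofRealHom * Z.1 * (imM Z)⁻¹.map Complex.ofRealHom := rfl
  rw [e, coe_eq_reM_add, mul_add, add_mul, Matrix.mul_smul, Matrix.smul_mul, mul_assoc _ _
    ((imM Z)⁻¹.map _), mul_assoc _ ((imM Z).map _), h, mul_one, omRe, omIm, Matrix.map_mul,
    Matrix.map_mul, mul_assoc]

theorem OmegaM_apply {n : ℕ} (Z : Siegel n) (i j : Fin n) :
    OmegaM Z i j = omRe Z i j + Complex.I * omIm Z i j := by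
  rw [OmegaM_eq]; simp

/-- `Ω` is the inverse of the conjugate of `Z`. -/
theorem OmegaM_mul_conj {n : ℕ} (Z : Siegel n) :
    OmegaM Z * Z.1.map (starRingEnd ℂ) = 1 := by
  have e : OmegaM Z = (wM Z)⁻¹.map Complex.ofRealHom * Z.1 * (imM Z)⁻¹.map Complex.ofRealHom := rfl
  have hc : Z.1.map (starRingEnd ℂ)
      = (reM Z).map Complex.ofRealHom - Complex.I • (imM Z).map Complex.ofRealHom := by
    ext i j
    apply Complex.ext <;> simp [reM, imM]
  have hZ := coe_eq_reM_add Z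
  have h1 : (imM Z).map Complex.ofRealHom * (imM Z)⁻¹.map Complex.ofRealHom = 1 := by
    rw [← Matrix.map_mul, Matrix.mul_nonsing_inv _ (imM_det Z)]; simp
  have h2 : (imM Z)⁻¹.map Complex.ofRealHom * (imM Z).map Complex.ofRealHom = 1 := by
    rw [← Matrix.map_mul, Matrix.nonsing_inv_mul _ (imM_det Z)]; simp
  have h3 : (wM Z)⁻¹.map Complex.ofRealHom * (wM Z).map Complex.ofRealHom = 1 := by
    rw [← Matrix.map_mul, Matrix.nonsing_inv_mul _ (wM_det Z)]; simp
  rw [e, mul_assoc, mul_assoc, hc, ← h3]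
  congr 1
  rw [hZ, wM, Matrix.map_add _ (map_add _), Matrix.map_mul, Matrix.map_mul]
  generalize (imM Z).map Complex.ofRealHom = Y at *
  generalize (imM Z)⁻¹.map Complex.ofRealHom = Y' at *
  generalize (reM Z).map Complex.ofRealHom = X at *
  -- The claim reduces to `Z Y⁻¹ Z̄ = W`; the mixed terms `±√-1 X` cancel.
  have : (X + Complex.I • Y) * (Y' * (X - Complex.I • Y))
      = X * Y' * X + Complex.I • ((Y * Y') * X) - Complex.I • (X * (Y' * Y))
        - (Complex.I * Complex.I) • ((Y * Y') * Y) := by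
    simp only [mul_sub, add_mul, Matrix.mul_smul, Matrix.smul_mul, mul_smul, mul_assoc]
    abel
  rw [this, h1, h2]
  simp [add_comm]

theorem conj_det_ne_zero {n : ℕ} (Z : Siegel n) : (Z.1.map (starRingEnd ℂ)).det ≠ 0 := by
  intro h
  have := congrArg Matrix.det (OmegaM_mul_conj Z)
  rw [Matrix.det_mul, h] at this
  simp at this

theorem OmegaM_eq_inv {n : ℕ} (Z : Siegel n) : OmegaM Z = (Z.1.map (starRingEnd ℂ))⁻¹ :=
  (Matrix.inv_eq_left_inv (OmegaM_mul_conj Z)).symm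

theorem OmegaM_transpose {n : ℕ} (Z : Siegel n) : (OmegaM Z)ᵀ = OmegaM Z := by
  rw [OmegaM_eq_inv, Matrix.transpose_nonsing_inv, ← Matrix.transpose_map, Z.2.1]

theorem OmegaM_symm {n : ℕ} (Z : Siegel n) (i j : Fin n) : OmegaM Z i j = OmegaM Z j i :=
  congrFun (congrFun (OmegaM_transpose Z) j) i

theorem omRe_symm {n : ℕ} (Z : Siegel n) (i j : Fin n) : omRe Z i j = omRe Z j i := by
  have := congrArg Complex.re (OmegaM_symm Z i j)
  simpa [OmegaM_apply] using this

/-- Cramer's rule: determinants are polynomial in the entries, and the inverse is the adjugate over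
the determinant. -/
theorem contDiff_inv_apply {E : Type*} [NormedAddCommGroup E] [NormedSpace ℝ E] {n : ℕ}
    {M : E → Matrix (Fin n) (Fin n) ℂ} (hM : ∀ i j, ContDiff ℝ ∞ fun x => M x i j)
    (hdet : ∀ x, (M x).det ≠ 0) (i j : Fin n) : ContDiff ℝ ∞ fun x => (M x)⁻¹ i j := by
  have hd : ∀ M' : E → Matrix (Fin n) (Fin n) ℂ, (∀ i j, ContDiff ℝ ∞ fun x => M' x i j) →
      ContDiff ℝ ∞ fun x => (M' x).det := by
    intro M' h
    simp only [Matrix.det_apply]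
    exact ContDiff.sum fun σ _ => (contDiff_prod fun i _ => h _ _).const_smul _
  simp only [Matrix.inv_def, Matrix.smul_apply, Ring.inverse_eq_inv', smul_eq_mul]
  refine ((hd M hM).inv hdet).mul ?_
  simp only [Matrix.adjugate_apply]
  refine hd _ fun k l => ?_
  by_cases hk : k = j
  · subst hk
    simp only [Matrix.updateRow_self]
    exact contDiff_const
  · simp only [Matrix.updateRow_ne hk]
    exact hM k l

theorem contDiff_OmegaM {n : ℕ} {Z : (Fin n → ℝ) → Siegel n} (hZ : SmoothSiegel Z) (i j : Fin n) :
    ContDiff ℝ ∞ fun x => OmegaM (Z x) i j := by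
  simp only [OmegaM_eq_inv]
  refine contDiff_inv_apply (fun k l => ?_) (fun x => conj_det_ne_zero (Z x)) i j
  exact Complex.conjCLE.contDiff.comp (hZ k l)

theorem contDiff_omRe {n : ℕ} {Z : (Fin n → ℝ) → Siegel n} (hZ : SmoothSiegel Z) (i j : Fin n) :
    ContDiff ℝ ∞ fun x => omRe (Z x) i j := by
  have : (fun x => omRe (Z x) i j) = fun x => Complex.reCLM (OmegaM (Z x) i j) := by
    ext x; simp [OmegaM_apply]
  rw [this]
  exact Complex.reCLM.contDiff.comp (contDiff_OmegaM hZ i j)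

theorem contDiff_omIm {n : ℕ} {Z : (Fin n → ℝ) → Siegel n} (hZ : SmoothSiegel Z) (i j : Fin n) :
    ContDiff ℝ ∞ fun x => omIm (Z x) i j := by
  have : (fun x => omIm (Z x) i j) = fun x => Complex.imCLM (OmegaM (Z x) i j) := by
    ext x; simp [OmegaM_apply]
  rw [this]
  exact Complex.imCLM.contDiff.comp (contDiff_OmegaM hZ i j)

/-! ### The complex structure and the Dirac operator in terms of `Ω` -/

theorem cplxJ_apply {n : ℕ} (Z : Siegel n) (v : Cov n) : cplxJ Z v =
    ((reM Z * (imM Z)⁻¹) *ᵥ v.1 - wM Z *ᵥ v.2,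
      (imM Z)⁻¹ *ᵥ v.1 - ((imM Z)⁻¹ * reM Z) *ᵥ v.2) := rfl

/-- This makes `(v, Ω v)` a complexified vector of type (0,1), and it is the only form in which `J`
enters most of what follows. -/
theorem cplxJ_omRe {n : ℕ} (Z : Siegel n) (v : Fin n → ℝ) :
    cplxJ Z (v, omRe Z *ᵥ v) = (0, omIm Z *ᵥ v) := by
  have h1 : wM Z * omRe Z = reM Z * (imM Z)⁻¹ := by
    rw [omRe, ← mul_assoc, ← mul_assoc, Matrix.mul_nonsing_inv _ (wM_det Z), one_mul]
  -- The symmetry of `Re Ω` allows the factors to be written in reverse order, which brings `W⁻¹` to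
  -- the right where `h2` needs it.
  have hT : omRe Z = (imM Z)⁻¹ * reM Z * (wM Z)⁻¹ := by
    have : (omRe Z)ᵀ = omRe Z := by ext i j; exact omRe_symm Z j i
    have hw : (wM Z)ᵀ = wM Z := by
      have := (wM_posDef Z).isHermitian
      rwa [Matrix.IsHermitian, Matrix.conjTranspose_eq_transpose_of_trivial] at this
    rw [← this, omRe, Matrix.transpose_mul, Matrix.transpose_mul, Matrix.transpose_nonsing_inv,
      Matrix.transpose_nonsing_inv, reM_transpose, imM_transpose, hw, mul_assoc]
  have h2 : (imM Z)⁻¹ - (imM Z)⁻¹ * reM Z * omRe Z = omIm Z := by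
    have h4 : omIm Z = (imM Z)⁻¹ * (wM Z - reM Z * (imM Z)⁻¹ * reM Z) * (wM Z)⁻¹ := by
      have : wM Z - reM Z * (imM Z)⁻¹ * reM Z = imM Z := by rw [wM]; abel
      rw [this, Matrix.nonsing_inv_mul _ (imM_det Z), one_mul, omIm]
    rw [h4, mul_sub, sub_mul, mul_assoc _ (wM Z), Matrix.mul_nonsing_inv _ (wM_det Z), mul_one, hT]
    simp only [mul_assoc]
  rw [cplxJ_apply]
  simp only [Matrix.mulVec_mulVec, h1, sub_self, ← Matrix.sub_mulVec, h2]

theorem exists_eq_add_omIm {n : ℕ} (Z : Siegel n) (u : Cov n) :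
    ∃ v w : Fin n → ℝ, u = (v, omRe Z *ᵥ v) + (0, omIm Z *ᵥ w) := by
  refine ⟨u.1, wM Z *ᵥ (u.2 - omRe Z *ᵥ u.1), Prod.ext (by simp) ?_⟩
  simp [omIm, Matrix.mulVec_mulVec, Matrix.nonsing_inv_mul _ (wM_det Z)]

theorem map_snd_eq_sum {n : ℕ} (T : Cov n →ₗ[ℝ] ℂ) (w : Fin n → ℝ) :
    T (0, w) = ∑ i, (w i : ℂ) * T (ddy i) := by
  have : ((0, w) : Cov n) = ∑ i, w i • (ddy i : Cov n) := by
    refine Prod.ext ?_ ?_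
    · simp [ddy, Prod.fst_sum]
    · ext j
      simp [ddy, Prod.snd_sum, Pi.single_apply]
  rw [this, map_sum]
  simp

theorem map_fst_eq_sum {n : ℕ} (T : Cov n →ₗ[ℝ] ℂ) (w : Fin n → ℝ) :
    T (w, 0) = ∑ i, (w i : ℂ) * T (ddx i) := by
  have : ((w, 0) : Cov n) = ∑ i, w i • (ddx i : Cov n) := by
    refine Prod.ext ?_ ?_
    · ext j
      simp [ddx, Prod.fst_sum, Pi.single_apply]
    · simp [ddx, Prod.snd_sum]
  rw [this, map_sum]
  simp

/-- The condition at `J v` is `-√-1` times the condition at `v`. Vectors `(v, Re Ω v)` and their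
images under `J` span the tangent space, so testing on the former suffices. -/
theorem forall_add_I_mul_cplxJ_iff {n : ℕ} (Z : Siegel n) (T : Cov n →ₗ[ℝ] ℂ) :
    (∀ v, T v + Complex.I * T (cplxJ Z v) = 0) ↔
      ∀ v : Fin n → ℝ, T (v, 0) + ∑ i, (∑ j, OmegaM Z i j * v j) * T (ddy i) = 0 := by
  have key : ∀ v : Fin n → ℝ, T (v, omRe Z *ᵥ v) + Complex.I * T (cplxJ Z (v, omRe Z *ᵥ v))
      = T (v, 0) + ∑ i, (∑ j, OmegaM Z i j * v j) * T (ddy i) := by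
    intro v
    have e : ((v, omRe Z *ᵥ v) : Cov n) = (v, 0) + (0, omRe Z *ᵥ v) := by simp
    rw [cplxJ_omRe, e, map_add, map_snd_eq_sum T (omRe Z *ᵥ v), map_snd_eq_sum, add_assoc,
      Finset.mul_sum, ← Finset.sum_add_distrib]
    congr 1
    refine Finset.sum_congr rfl fun i _ => ?_
    rw [← mul_assoc, ← add_mul]
    congr 1
    simp only [Matrix.mulVec, dotProduct, Complex.ofReal_sum, Finset.mul_sum,
      ← Finset.sum_add_distrib, OmegaM_apply, Complex.ofReal_mul]
    exact Finset.sum_congr rfl fun j _ => by ring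
  refine ⟨fun h v => by rw [← key, h], fun h u => ?_⟩
  obtain ⟨v, w, rfl⟩ := exists_eq_add_omIm Z u
  have hv := h v
  have hw := h w
  rw [← key] at hv hw
  rw [cplxJ_omRe] at hw
  have hJ : cplxJ Z (0, omIm Z *ᵥ w) = -(w, omRe Z *ᵥ w) := by
    rw [← cplxJ_omRe, cplxJ_cplxJ]
  simp only [map_add, hJ, map_neg]
  linear_combination hv - Complex.I * hw + T (0, omIm Z *ᵥ w) * Complex.I_sq

theorem omega0_apply {n : ℕ} (u v : Cov n) : omega0 n u v = u.1 ⬝ᵥ v.2 - u.2 ⬝ᵥ v.1 := rfl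

theorem omega0_cplxJ_cplxJ {n : ℕ} (Z : Siegel n) (u v : Cov n) :
    omega0 n (cplxJ Z u) (cplxJ Z v) = omega0 n u v := by
  have sR : ∀ a b : Fin n → ℝ, a ⬝ᵥ omRe Z *ᵥ b = (omRe Z *ᵥ a) ⬝ᵥ b := by
    intro a b
    rw [Matrix.dotProduct_mulVec]
    congr 1
    rw [← Matrix.mulVec_transpose]
    congr 1
    ext i j; exact omRe_symm Z j i
  have sI : ∀ a b : Fin n → ℝ, a ⬝ᵥ omIm Z *ᵥ b = (omIm Z *ᵥ a) ⬝ᵥ b := by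
    intro a b
    rw [Matrix.dotProduct_mulVec]
    congr 1
    rw [← Matrix.mulVec_transpose]
    congr 1
    simpa [Matrix.IsHermitian, Matrix.conjTranspose_eq_transpose_of_trivial] using
      (omIm_posDef Z).isHermitian
  have hJ : ∀ w, cplxJ Z (0, omIm Z *ᵥ w) = -(w, omRe Z *ᵥ w) := fun w => by
    rw [← cplxJ_omRe, cplxJ_cplxJ]
  obtain ⟨a, b, rfl⟩ := exists_eq_add_omIm Z u
  obtain ⟨c, e, rfl⟩ := exists_eq_add_omIm Z v
  simp only [map_add, hJ, cplxJ_omRe, map_neg, LinearMap.add_apply, LinearMap.neg_apply,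
    omega0_apply, sR, sI, dotProduct_zero]
  simp only [Matrix.mulVec_zero, zero_dotProduct]
  ring

/-- `∇ s` at `p` as a linear map. -/
def nablaLM {n : ℕ} (N : ℕ) (s : Cov n → ℂ) (p : Cov n) : Cov n →ₗ[ℝ] ℂ where
  toFun := nabla N s p
  map_add' v w := by
    simp only [nabla, map_add, Prod.snd_add, dotProduct_add, Complex.ofReal_add]; ring
  map_smul' a v := by
    simp only [nabla, map_smul, Prod.smul_snd, dotProduct_smul, smul_eq_mul, Complex.ofReal_mul,
      Complex.real_smul, RingHom.id_apply]
    ring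

theorem nablaLM_apply {n : ℕ} (N : ℕ) (s : Cov n → ℂ) (p v : Cov n) :
    nablaLM N s p v = nabla N s p v := rfl

theorem flat_sharp {n N : ℕ} (hN : 0 < N) (Z : Siegel n) (τ : Module.Dual ℝ (Cov n)) :
    flat N Z (sharp hN Z τ) = τ :=
  (LinearEquiv.ofBijective (flat N Z) (flat_bijective hN Z)).apply_symm_apply τ

/-- Invariance of `ω₀` under `J` gives `g(J u, v) = -g(u, J v)`. The right side is the real part of
`z (τ v + √-1 τ(J v))`, the shape in which the (0,1)-part of `∇` appears. -/
theorem flat_clifford {n N : ℕ} (hN : 0 < N) (Z : Siegel n) (τ : Module.Dual ℝ (Cov n)) (z : ℂ)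
    (v : Cov n) : flat N Z (clifford Z (sharp hN Z τ) z) v = z.re * τ v - z.im * τ (cplxJ Z v) := by
  have h1 := fun v => LinearMap.congr_fun (flat_sharp hN Z τ) v
  have h2 := h1 (cplxJ Z v)
  simp only [clifford, map_add, map_smul, LinearMap.add_apply, LinearMap.smul_apply, smul_eq_mul,
    h1 v]
  simp only [flat_apply, cplxJ_cplxJ, map_neg, omega0_cplxJ_cplxJ] at h2 ⊢
  linear_combination - z.im * h2

theorem flat_dirac {n N : ℕ} (hN : 0 < N) (Z : (Fin n → ℝ) → Siegel n) (s : Cov n → ℂ)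
    (p v : Cov n) : flat N (Z p.1) (dirac hN Z s p) v
      = (nabla N s p v + Complex.I * nabla N s p (cplxJ (Z p.1) v)).re := by
  have hT : ∀ w : Cov n, nabla N s p w =
      ∑ i, ((w.1 i : ℂ) * nabla N s p (ddx i) + (w.2 i : ℂ) * nabla N s p (ddy i)) := by
    intro w
    have e : w = (w.1, 0) + (0, w.2) := by simp
    rw [Finset.sum_add_distrib]
    conv_lhs => rw [e, ← nablaLM_apply, map_add, map_fst_eq_sum, map_snd_eq_sum]
    rfl
  rw [hT v, hT (cplxJ (Z p.1) v)]
  simp only [dirac, map_sum, map_add, LinearMap.sum_apply, LinearMap.add_apply, flat_clifford]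
  rw [Complex.add_re, Complex.I_mul_re, Complex.re_sum, Complex.im_sum, ← Finset.sum_neg_distrib,
    ← Finset.sum_add_distrib]
  refine Finset.sum_congr rfl fun i _ => ?_
  simp [dx, dy]
  ring

theorem dirac_eq_zero_iff {n N : ℕ} (hN : 0 < N) (Z : (Fin n → ℝ) → Siegel n) (s : Cov n → ℂ) :
    (∀ p, dirac hN Z s p = 0) ↔ IsHolomorphic N Z s := by
  constructor
  · intro h p v
    have hr : ∀ w, (nabla N s p w + Complex.I * nabla N s p (cplxJ (Z p.1) w)).re = 0 := by
      intro w; rw [← flat_dirac hN, h, map_zero]; rfl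
    refine Complex.ext (hr v) ?_
    -- The imaginary part of the expression at `v` is its real part at `J v`.
    have := hr (cplxJ (Z p.1) v)
    rw [cplxJ_cplxJ, ← nablaLM_apply, ← nablaLM_apply N s p (-v), map_neg] at this
    simpa [nablaLM_apply, add_comm] using this
  · intro h p
    apply (flat_bijective hN (Z p.1)).1
    rw [map_zero]
    refine LinearMap.ext fun v => ?_
    rw [flat_dirac hN, h p v]
    rfl

theorem isHolomorphic_iff {n N : ℕ} (Z : (Fin n → ℝ) → Siegel n) (s : Cov n → ℂ) :
    IsHolomorphic N Z s ↔ ∀ (p : Cov n) (v : Fin n → ℝ), fderiv ℝ s p (v, 0)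
      + ∑ i, (∑ j, OmegaM (Z p.1) i j * v j)
        * (fderiv ℝ s p (ddy i) - 2 * Real.pi * Complex.I * N * p.1 i * s p) = 0 := by
  refine forall_congr' fun p => ?_
  have := forall_add_I_mul_cplxJ_iff (Z p.1) (nablaLM N s p)
  simp only [nablaLM_apply] at this
  rw [this]
  simp [nabla, ddy]

/-! ### Closed one-forms on `ℝⁿ` -/

/-- The two ends of the leg `i` are the corners with `i` and `i + 1` coordinates replaced by those
of `b`, so the integrals over the legs telescope. -/
theorem stair_last_step {n : ℕ} (b x : Fin n → ℝ) (i : Fin n) (j : ℕ) (hj : i.1 = j) :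
    stair b x i (x i) = (fun k => if k.1 < j then b k else x k) ∧
      stair b x i (b i) = (fun k => if k.1 < j + 1 then b k else x k) := by
  subst hj
  constructor <;> ext k <;> simp only [stair, Fin.lt_def, Fin.ext_iff]
  · split_ifs with h1 h2
    · rfl
    · rw [Fin.ext h2]
    · rfl
  · by_cases h1 : k.1 < i.1
    · simp [h1, Nat.lt_succ_of_lt h1]
    · by_cases h2 : k.1 = i.1
      · simp [Fin.ext h2]
      · have : ¬ k.1 < i.1 + 1 := by omega
        simp [h1, h2, this]

/-- A primitive of a closed one-form on `ℝⁿ` is given by integration along a staircase. -/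
theorem hasFDerivAt_sum_integral_stair {n : ℕ} {E : Type*} [NormedAddCommGroup E]
    [NormedSpace ℝ E] [CompleteSpace E] {α : Fin n → (Fin n → ℝ) → E}
    (hα : ∀ i, Differentiable ℝ (α i))
    (hcl : ∀ i j x, fderiv ℝ (α j) x (Pi.single i 1) = fderiv ℝ (α i) x (Pi.single j 1))
    (b x : Fin n → ℝ) :
    HasFDerivAt (fun x => ∑ i, ∫ t in (b i)..(x i), α i (stair b x i t))
      (∑ i, (ContinuousLinearMap.proj i : (Fin n → ℝ) →L[ℝ] ℝ).smulRight (α i x)) x := by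
  set θ : (Fin n → ℝ) → (Fin n → ℝ) →L[ℝ] E := fun x =>
    ∑ i, (ContinuousLinearMap.proj i : (Fin n → ℝ) →L[ℝ] ℝ).smulRight (α i x) with hθ
  have hθd : ∀ x, HasFDerivAt θ (∑ i, (ContinuousLinearMap.smulRightL ℝ (Fin n → ℝ) E
      (ContinuousLinearMap.proj i)) ∘L fderiv ℝ (α i) x) x := by
    intro x
    refine HasFDerivAt.fun_sum fun i _ => ?_
    exact (ContinuousLinearMap.smulRightL ℝ (Fin n → ℝ) E
      (ContinuousLinearMap.proj i)).hasFDerivAt.comp x (hα i x).hasFDerivAt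
  -- Closedness of `θ = ∑ αᵢ dxᵢ`, as required by the Poincaré lemma on the convex set `ℝⁿ`. The
  -- primitive `f` obtained from it then identifies the staircase integral as `f x - f b`.
  have hsymm : ∀ x v w, fderiv ℝ θ x v w = fderiv ℝ θ x w v := by
    intro x v w
    have hb : ∀ i (v : Fin n → ℝ), fderiv ℝ (α i) x v
        = ∑ j, v j • fderiv ℝ (α i) x (Pi.single j 1) := by
      intro i v
      conv_lhs => rw [pi_eq_sum_univ' v]
      simp [map_sum, map_smul]
    have : ∀ v w : Fin n → ℝ, fderiv ℝ θ x v w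
        = ∑ i, ∑ j, (w i * v j) • fderiv ℝ (α i) x (Pi.single j 1) := by
      intro v w
      rw [(hθd x).fderiv]
      simp only [sum_apply, ContinuousLinearMap.comp_apply]
      refine Finset.sum_congr rfl fun i _ => ?_
      change w i • fderiv ℝ (α i) x v = _
      rw [hb i v, Finset.smul_sum]
      exact Finset.sum_congr rfl fun j _ => smul_smul _ _ _
    rw [this, this, Finset.sum_comm]
    exact Finset.sum_congr rfl fun i _ => Finset.sum_congr rfl fun j _ => by
      rw [hcl, mul_comm]
  obtain ⟨f, hf⟩ := convex_univ.exists_forall_hasFDerivAt_of_fderiv_symmetric isOpen_univ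
    (fun x _ => (hθd x).differentiableAt.differentiableWithinAt) (fun x _ => hsymm x)
  have hint : ∀ x i, ∫ t in (b i)..(x i), α i (stair b x i t)
      = f (stair b x i (x i)) - f (stair b x i (b i)) := by
    intro x i
    have hst : ∀ t, HasDerivAt (stair b x i) (Pi.single i 1) t := by
      intro t
      rw [hasDerivAt_pi]
      intro k
      unfold stair
      by_cases hk : k = i
      · subst hk
        simpa using! hasDerivAt_id t
      · simpa [hk] using hasDerivAt_const t _
    have hα' : Continuous fun t => α i (stair b x i t) :=
      (hα i).continuous.comp (continuous_iff_continuousAt.2 fun t => (hst t).continuousAt)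
    refine intervalIntegral.integral_eq_sub_of_hasDerivAt (f := fun t => f (stair b x i t))
      (fun t _ => ?_) (hα'.intervalIntegrable _ _)
    have := (hf (stair b x i t) trivial).comp_hasDerivAt t (hst t)
    convert! this using 1
    simp [hθ, Pi.single_apply]
  have hsum : ∀ x, ∑ i, ∫ t in (b i)..(x i), α i (stair b x i t) = f x - f b := by
    intro x
    set g : ℕ → E := fun j => f (fun k => if k.1 < j then b k else x k) with hg
    have h1 : ∀ i : Fin n, ∫ t in (b i)..(x i), α i (stair b x i t) = g i.1 - g (i.1 + 1) := by
      intro i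
      rw [hint, (stair_last_step b x i _ rfl).1, (stair_last_step b x i _ rfl).2]
    rw [Finset.sum_congr rfl fun i _ => h1 i, Fin.sum_univ_eq_sum_range (fun i => g i - g (i + 1)),
      Finset.sum_range_sub']
    simp [hg]
  simp only [hsum]
  exact (hf x trivial).sub_const _

/-! ### Modes -/

/-- `(Ω (m - N x))_j`. -/
def bsForm {n : ℕ} (N : ℕ) (Z : (Fin n → ℝ) → Siegel n) (m : Fin n → ℤ) (j : Fin n)
    (x : Fin n → ℝ) : ℂ :=
  ∑ k, OmegaM (Z x) j k * ((m k : ℂ) - N * (x k : ℂ))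

theorem contDiff_bsForm {n : ℕ} (N : ℕ) {Z : (Fin n → ℝ) → Siegel n} (hZ : SmoothSiegel Z)
    (m : Fin n → ℤ) (j : Fin n) : ContDiff ℝ ∞ (bsForm N Z m j) := by
  refine ContDiff.sum fun k _ => (contDiff_OmegaM hZ j k).mul ?_
  exact contDiff_const.sub (contDiff_const.mul (Complex.ofRealCLM.contDiff.comp
    (contDiff_apply ℝ ℝ k)))

/-- Differentiating the factor `m - N x` contributes `-N Ωⱼᵢ`, which is symmetric and drops out. The
commutativity condition is therefore closedness of the one-form `Ω(m - N x)·dx`. -/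
theorem commutativity_iff {n : ℕ} (N : ℕ) {Z : (Fin n → ℝ) → Siegel n} (hZ : SmoothSiegel Z)
    (m : Fin n → ℤ) : Commutativity N Z m ↔ ∀ i j x,
      fderiv ℝ (bsForm N Z m j) x (Pi.single i 1) = fderiv ℝ (bsForm N Z m i) x (Pi.single j 1) := by
  have key : ∀ i j x, fderiv ℝ (bsForm N Z m j) x (Pi.single i 1)
      = ∑ k, fderiv ℝ (fun x' => OmegaM (Z x') j k) x (Pi.single i 1) * ((m k : ℂ) - N * (x k : ℂ))
        - N * OmegaM (Z x) j i := by
    intro i j x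
    have h1 : ∀ k, HasFDerivAt (fun x : Fin n → ℝ => (m k : ℂ) - N * (x k : ℂ))
        (-((N : ℂ) • (Complex.ofRealCLM ∘L ContinuousLinearMap.proj k))) x := by
      intro k
      have h2 : HasFDerivAt (fun x : Fin n → ℝ => ((x k : ℝ) : ℂ))
          (Complex.ofRealCLM ∘L ContinuousLinearMap.proj k) x :=
        (Complex.ofRealCLM ∘L ContinuousLinearMap.proj (R := ℝ) (φ := fun _ : Fin n => ℝ) k).hasFDerivAt
      exact (h2.const_mul (N : ℂ)).const_sub (m k : ℂ)
    have h3 : HasFDerivAt (bsForm N Z m j) _ x := HasFDerivAt.fun_sum fun k _ =>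
      (((contDiff_OmegaM hZ j k).differentiable (by simp)) x).hasFDerivAt.mul (h1 k)
    rw [h3.fderiv]
    simp only [sum_apply, add_apply,
      smul_apply, neg_apply,
      ContinuousLinearMap.comp_apply, ContinuousLinearMap.proj_apply, smul_eq_mul,
      Complex.ofRealCLM_apply, Finset.sum_add_distrib]
    rw [add_comm, sub_eq_add_neg]
    congr 1
    · exact Finset.sum_congr rfl fun k _ => mul_comm _ _
    · rw [Finset.sum_eq_single i]
      · simp; ring
      · intro k _ hk; simp [hk]
      · simp
  refine forall_congr' fun i => forall_congr' fun j => forall_congr' fun x => ?_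
  rw [key, key, OmegaM_symm (Z x) i j, sub_left_inj]

/-- The complex-valued covector `dx_j`. -/
def dxL {n : ℕ} (j : Fin n) : Cov n →L[ℝ] ℂ :=
  Complex.ofRealCLM ∘L ContinuousLinearMap.proj j ∘L ContinuousLinearMap.fst ℝ _ _

/-- The complex-valued covector `dy_j`. -/
def dyL {n : ℕ} (j : Fin n) : Cov n →L[ℝ] ℂ :=
  Complex.ofRealCLM ∘L ContinuousLinearMap.proj j ∘L ContinuousLinearMap.snd ℝ _ _

@[simp] theorem dxL_apply {n : ℕ} (j : Fin n) (v : Cov n) : dxL j v = (v.1 j : ℂ) := rfl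

@[simp] theorem dyL_apply {n : ℕ} (j : Fin n) (v : Cov n) : dyL j v = (v.2 j : ℂ) := rfl

/-- The logarithmic derivative of the holomorphic functions of weight `k` on the fibres. -/
def modeForm {n : ℕ} (N : ℕ) (Z : (Fin n → ℝ) → Siegel n) (k : Fin n → ℤ) (p : Cov n) :
    Cov n →L[ℝ] ℂ :=
  (2 * Real.pi * Complex.I : ℂ) • ∑ j, ((k j : ℂ) • dyL j - bsForm N Z k j p.1 • dxL j)

theorem modeForm_apply {n : ℕ} (N : ℕ) (Z : (Fin n → ℝ) → Siegel n) (k : Fin n → ℤ)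
    (p v : Cov n) : modeForm N Z k p v
      = 2 * Real.pi * Complex.I * ∑ j, ((k j : ℂ) * v.2 j - bsForm N Z k j p.1 * v.1 j) := by
  simp [modeForm]

theorem contDiff_modeForm {n : ℕ} (N : ℕ) {Z : (Fin n → ℝ) → Siegel n} (hZ : SmoothSiegel Z)
    (k : Fin n → ℤ) : ContDiff ℝ ∞ (modeForm N Z k) := by
  refine ContDiff.const_smul _ (ContDiff.sum fun j _ => contDiff_const.sub ?_)
  exact ((contDiff_bsForm N hZ k j).comp contDiff_fst).smul contDiff_const

/-- `f` is a holomorphic function on `ℝⁿ × ℝⁿ` with weight `k` under translations in the fibres. -/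
def IsMode {n : ℕ} (N : ℕ) (Z : (Fin n → ℝ) → Siegel n) (k : Fin n → ℤ) (f : Cov n → ℂ) : Prop :=
  ∀ p, HasFDerivAt f (f p • modeForm N Z k p) p

/-- The weight prescribes the derivatives along the fibres; the holomorphy equation then expresses
the derivatives in `x` through them, so all of `df` is prescribed. -/
theorem isMode_iff {n N : ℕ} {Z : (Fin n → ℝ) → Siegel n} {k : Fin n → ℤ} {f : Cov n → ℂ} :
    IsMode N Z k f ↔ Differentiable ℝ f ∧ IsHolomorphic N Z f ∧
      ∀ p i, fderiv ℝ f p (ddy i) = 2 * Real.pi * Complex.I * k i * f p := by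
  have hy : ∀ p i, modeForm N Z k p (ddy i) = 2 * Real.pi * Complex.I * k i := by
    intro p i
    rw [modeForm_apply, Finset.sum_eq_single i]
    · simp [ddy]
    · intro j _ hj; simp [ddy, hj]
    · simp
  -- The form `modeForm` itself solves the holomorphy equation divided by `f`; this uses the
  -- symmetry of `Ω`.
  have hx : ∀ (p : Cov n) (v : Fin n → ℝ), modeForm N Z k p (v, 0)
      + ∑ i, (∑ j, OmegaM (Z p.1) i j * v j)
        * (2 * Real.pi * Complex.I * k i - 2 * Real.pi * Complex.I * N * p.1 i) = 0 := by
    intro p v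
    rw [modeForm_apply]
    simp only [bsForm, Pi.zero_apply, Complex.ofReal_zero, mul_zero, zero_sub, Finset.mul_sum,
      Finset.sum_mul, Finset.sum_neg_distrib, mul_neg]
    rw [neg_add_eq_zero, Finset.sum_comm]
    refine Finset.sum_congr rfl fun i _ => Finset.sum_congr rfl fun j _ => ?_
    rw [OmegaM_symm (Z p.1) i j]
    ring
  rw [isHolomorphic_iff]
  constructor
  · intro h
    have hd : ∀ p i, fderiv ℝ f p (ddy i) = 2 * Real.pi * Complex.I * k i * f p := by
      intro p i
      rw [(h p).fderiv, smul_apply, hy, smul_eq_mul, mul_comm]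
    refine ⟨fun p => (h p).differentiableAt, fun p v => ?_, hd⟩
    simp only [hd]
    rw [(h p).fderiv, smul_apply, smul_eq_mul]
    rw [← mul_zero (f p), ← hx p v, mul_add, Finset.mul_sum]
    congr 1
    exact Finset.sum_congr rfl fun i _ => by ring
  · rintro ⟨hf, hol, hd⟩ p
    have he : fderiv ℝ f p = f p • modeForm N Z k p := by
      refine ContinuousLinearMap.ext fun v => ?_
      have e : v = (v.1, 0) + (0, v.2) := by simp
      rw [e, map_add, map_add]
      congr 1
      · have h1 := hol p v.1
        have h2 := hx p v.1
        simp only [hd] at h1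
        rw [smul_apply, smul_eq_mul, eq_neg_of_add_eq_zero_left h1,
          eq_neg_of_add_eq_zero_left h2, mul_neg, Finset.mul_sum]
        congr 1
        exact Finset.sum_congr rfl fun i _ => by ring
      · have h1 := map_snd_eq_sum (fderiv ℝ f p).toLinearMap v.2
        have h2 := map_snd_eq_sum (f p • modeForm N Z k p).toLinearMap v.2
        simp only [ContinuousLinearMap.coe_coe] at h1 h2
        rw [h1, h2]
        refine Finset.sum_congr rfl fun i _ => ?_
        rw [hd, smul_apply, hy, smul_eq_mul, mul_comm (f p)]
    rw [← he]
    exact (hf p).hasFDerivAt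

/-! ### Regularity, rigidity and existence of modes -/

namespace IsMode

variable {n N : ℕ} {Z : (Fin n → ℝ) → Siegel n} {k : Fin n → ℤ} {f g : Cov n → ℂ}

/-- Bootstrapping: `df` is `f` times a smooth form, so it is as smooth as `f`. -/
theorem contDiff (hZ : SmoothSiegel Z) (hf : IsMode N Z k f) : ContDiff ℝ ∞ f := by
  rw [contDiff_infty]
  intro r
  induction r with
  | zero => exact contDiff_zero.2 (continuous_iff_continuousAt.2 fun p => (hf p).continuousAt)
  | succ r ih =>
    have : ((r + 1 : ℕ) : WithTop ℕ∞) = (r : WithTop ℕ∞) + 1 := by simp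
    rw [this, contDiff_succ_iff_hasFDerivAt]
    exact ⟨_, ih.smul ((contDiff_modeForm N hZ k).of_le (by exact_mod_cast le_top)), hf⟩

theorem sub_const_smul (hf : IsMode N Z k f) (hg : IsMode N Z k g) (c : ℂ) :
    IsMode N Z k (fun p => g p - c * f p) := by
  intro p
  have := (hg p).sub ((hf p).const_mul c)
  convert! this using 1
  rw [smul_smul, ← sub_smul]

/-- Along a segment a mode solves a linear scalar differential equation; dividing by the exponential
of the integrated coefficient leaves a constant. -/
theorem add_eq (hZ : SmoothSiegel Z) (hf : IsMode N Z k f) (p w : Cov n) :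
    f (p + w) = f p * Complex.exp (∫ t in (0 : ℝ)..1, modeForm N Z k (p + t • w) w) := by
  set l : ℝ → ℂ := fun t => modeForm N Z k (p + t • w) w with hl
  have hlc : Continuous l := by
    have h1 : Continuous fun t : ℝ => modeForm N Z k (p + t • w) :=
      (contDiff_modeForm N hZ k).continuous.comp (by fun_prop)
    exact h1.clm_apply continuous_const
  have hL : ∀ t, HasDerivAt (fun t => ∫ s in (0 : ℝ)..t, l s) (l t) t := fun t =>
    intervalIntegral.integral_hasDerivAt_right (hlc.intervalIntegrable _ _)
      hlc.aestronglyMeasurable.stronglyMeasurableAtFilter hlc.continuousAt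
  have hline : ∀ t : ℝ, HasDerivAt (fun t : ℝ => p + t • w) w t := by
    intro t
    simpa using ((hasDerivAt_id t).smul_const w).const_add p
  have hφ : ∀ t, HasDerivAt (fun t : ℝ => f (p + t • w) * Complex.exp (-∫ s in (0 : ℝ)..t, l s))
      0 t := by
    intro t
    have h1 := (hf (p + t • w)).comp_hasDerivAt t (hline t)
    have h2 := ((hL t).neg).cexp
    have h3 := h1.mul h2
    convert! h3 using 1
    simp only [smul_apply, smul_eq_mul, Function.comp, Pi.neg_apply]
    change 0 = f (p + t • w) * l t * _ + _
    ring
  have hconst := is_const_of_deriv_eq_zero (fun t => (hφ t).differentiableAt)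
    (fun t => (hφ t).deriv) 1 0
  simp only [one_smul, zero_smul, add_zero, intervalIntegral.integral_same, neg_zero,
    Complex.exp_zero, mul_one] at hconst
  rw [← hconst, mul_assoc, ← Complex.exp_add, neg_add_cancel, Complex.exp_zero, mul_one]

theorem translate (hZ : SmoothSiegel Z) (hf : IsMode N Z k f) (x y h : Fin n → ℝ) :
    f (x, y + h) = f (x, y) * Complex.exp (2 * Real.pi * Complex.I * ∑ j, (k j : ℂ) * h j) := by
  have e : ((x, y + h) : Cov n) = (x, y) + (0, h) := by simp
  rw [e, hf.add_eq hZ]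
  simp [modeForm_apply]

theorem eq_zero_of_apply_eq_zero (hZ : SmoothSiegel Z) (hf : IsMode N Z k f) {p : Cov n}
    (hp : f p = 0) (q : Cov n) : f q = 0 := by
  have := hf.add_eq hZ p (q - p)
  rwa [add_sub_cancel, hp, zero_mul] at this

/-- The combination of `g` and `f` that vanishes at `p` is again a mode, hence zero: modes of one
weight form a space of dimension at most one. -/
theorem eq_mul (hZ : SmoothSiegel Z) (hf : IsMode N Z k f) (hg : IsMode N Z k g) {p : Cov n}
    (hp : f p ≠ 0) (q : Cov n) : g q = g p / f p * f q := by
  have := (hf.sub_const_smul hg (g p / f p)).eq_zero_of_apply_eq_zero hZ (p := p)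
    (by field_simp; simp) q
  exact sub_eq_zero.1 this

/-- With `df = f λ`, the second derivative of `f` is `f (λ ⊗ λ + Dλ)`. It is symmetric and `f` has
no zeros, so `Dλ` is symmetric; its `dx` part is the closedness sought. -/
theorem commutativity (hZ : SmoothSiegel Z) (hf : IsMode N Z k f) {p₀ : Cov n} (hp₀ : f p₀ ≠ 0) :
    Commutativity N Z k := by
  rw [commutativity_iff N hZ]
  intro i j x
  set p : Cov n := (x, 0) with hp
  have hfp : f p ≠ 0 := fun h => hp₀ (hf.eq_zero_of_apply_eq_zero hZ h p₀)
  have hΛ : HasFDerivAt (modeForm N Z k) (fderiv ℝ (modeForm N Z k) p) p :=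
    (((contDiff_modeForm N hZ k).differentiable (by simp)) p).hasFDerivAt
  have h2 := second_derivative_symmetric (𝕜 := ℝ) hf ((hf p).smul hΛ) (ddx i) (ddx j)
  have hv : ∀ (q : Cov n) (j : Fin n), modeForm N Z k q (ddx j)
      = -(2 * Real.pi * Complex.I) * bsForm N Z k j q.1 := by
    intro q j
    rw [modeForm_apply, Finset.sum_eq_single j]
    · simp [ddx]
    · intro l _ hl; simp [ddx, hl]
    · simp
  have hd : ∀ i j : Fin n, fderiv ℝ (modeForm N Z k) p (ddx i) (ddx j)
      = -(2 * Real.pi * Complex.I) * fderiv ℝ (bsForm N Z k j) x (Pi.single i 1) := by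
    intro i j
    have h1 : HasFDerivAt (fun q => modeForm N Z k q (ddx j))
        ((ContinuousLinearMap.apply ℝ ℂ (ddx j : Cov n)) ∘L fderiv ℝ (modeForm N Z k) p) p :=
      (ContinuousLinearMap.apply ℝ ℂ (ddx j : Cov n)).hasFDerivAt.comp p hΛ
    have h3 : HasFDerivAt (fun q : Cov n => -(2 * Real.pi * Complex.I) * bsForm N Z k j q.1)
        (-(2 * Real.pi * Complex.I : ℂ) •
          ((fderiv ℝ (bsForm N Z k j) x) ∘L ContinuousLinearMap.fst ℝ _ _)) p := by
      refine HasFDerivAt.const_mul ?_ _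
      exact HasFDerivAt.comp (g := bsForm N Z k j) p
        (((contDiff_bsForm N hZ k j).differentiable (by simp)) x).hasFDerivAt hasFDerivAt_fst
    simp only [hv] at h1
    have := congrArg (fun L : Cov n →L[ℝ] ℂ => L (ddx i)) (h1.unique h3)
    simpa [ddx] using this
  simp only [add_apply, smul_apply,
    ContinuousLinearMap.smulRight_apply, hd, hv, smul_eq_mul] at h2
  have hpi : (2 * Real.pi * Complex.I : ℂ) * f p ≠ 0 :=
    mul_ne_zero Complex.two_pi_I_ne_zero hfp
  apply mul_left_cancel₀ hpi
  linear_combination -h2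

end IsMode

/-- The function `a_m(x) exp(2π√-1 m·y)`. -/
def baseMode {n : ℕ} (N : ℕ) (Z : (Fin n → ℝ) → Siegel n) (m : Fin n → ℤ) (p : Cov n) : ℂ :=
  aSol N Z m p.1 * Complex.exp (2 * Real.pi * Complex.I * ∑ j, (m j : ℂ) * p.2 j)

theorem baseMode_ne_zero {n : ℕ} (N : ℕ) (Z : (Fin n → ℝ) → Siegel n) (m : Fin n → ℤ)
    (p : Cov n) : baseMode N Z m p ≠ 0 :=
  mul_ne_zero (Complex.exp_ne_zero _) (Complex.exp_ne_zero _)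

theorem isMode_baseMode {n N : ℕ} {Z : (Fin n → ℝ) → Siegel n} (hZ : SmoothSiegel Z)
    {m : Fin n → ℤ} (hm : Commutativity N Z m) : IsMode N Z m (baseMode N Z m) := by
  intro p
  rw [commutativity_iff N hZ] at hm
  have h1 := hasFDerivAt_sum_integral_stair
    (fun i => (contDiff_bsForm N hZ m i).differentiable (by simp)) hm (bsPoint N m) p.1
  have h2 := ((HasFDerivAt.comp p h1 hasFDerivAt_fst).const_mul
    (-(2 * Real.pi * Complex.I : ℂ))).cexp
  have h3 : HasFDerivAt (fun p : Cov n => ∑ j, (m j : ℂ) * (p.2 j : ℂ))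
      (∑ j, (m j : ℂ) • dyL j) p :=
    HasFDerivAt.fun_sum fun j _ => (dyL j).hasFDerivAt.const_mul (m j : ℂ)
  have h4 := (h3.const_mul (2 * Real.pi * Complex.I : ℂ)).cexp
  have h5 := h2.mul h4
  have e : baseMode N Z m = (fun x => Complex.exp (-(2 * Real.pi * Complex.I : ℂ) *
      ((fun x => ∑ i, ∫ t in (bsPoint N m i)..(x i), bsForm N Z m i (stair (bsPoint N m) x i t)) ∘
        Prod.fst) x)) * fun p : Cov n =>
      Complex.exp (2 * Real.pi * Complex.I * ∑ j, (m j : ℂ) * (p.2 j : ℂ)) := rfl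
  rw [e]
  convert! h5 using 1
  refine ContinuousLinearMap.ext fun v => ?_
  simp only [smul_apply, modeForm_apply, add_apply,
    sum_apply, ContinuousLinearMap.comp_apply, smul_eq_mul, dyL_apply,
    ContinuousLinearMap.smulRight_apply, ContinuousLinearMap.proj_apply, Pi.mul_apply,
    ContinuousLinearMap.coe_fst', Complex.real_smul, Finset.sum_sub_distrib]
  have : ∑ j, bsForm N Z m j p.1 * (v.1 j : ℂ) = ∑ j, (v.1 j : ℂ) * bsForm N Z m j p.1 :=
    Finset.sum_congr rfl fun j _ => mul_comm _ _
  rw [this]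
  ring

/-! ### Exponential decay of bounded modes -/

theorem abs_le_norm_intVec {n : ℕ} (k : Fin n → ℤ) (i : Fin n) : |(k i : ℝ)| ≤ ‖intVec k‖ :=
  norm_le_pi_norm (intVec k) i

theorem intVec_injective {n : ℕ} : Function.Injective (intVec : (Fin n → ℤ) → Fin n → ℝ) := by
  intro k l h
  ext i
  exact Int.cast_injective (α := ℝ) (congrFun h i)

theorem summable_inv_norm_intVec_pow (n : ℕ) :
    Summable fun k : Fin n → ℤ => ‖intVec k‖⁻¹ ^ (n + 1) := by
  set b := Pi.basisFun ℝ (Fin n)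
  set L := Submodule.span ℤ (Set.range b)
  have hr : Module.finrank ℤ L < n + 1 := by
    have : Module.finrank ℤ L = n := by
      rw [ZLattice.rank ℝ L]; simp
    omega
  have hmem : ∀ k : Fin n → ℤ, intVec k ∈ L := by
    intro k
    have : intVec k = ∑ i, k i • b i := by
      ext j
      simp [intVec, b, Finset.sum_apply, Pi.single_apply]
    rw [this]
    exact Submodule.sum_mem _ fun i _ => Submodule.smul_mem _ _ (Submodule.subset_span ⟨i, rfl⟩)
  exact (ZLattice.summable_norm_pow_inv L (n + 1) hr).comp_injective
    (i := fun k : Fin n → ℤ => (⟨intVec k, hmem k⟩ : L))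
    (fun k l h => intVec_injective (congrArg Subtype.val h))

theorem summable_pow_mul_exp_neg_norm_intVec (n d : ℕ) {c : ℝ} (hc : 0 < c) :
    Summable fun k : Fin n → ℤ => (1 + ‖intVec k‖) ^ d * Real.exp (-c * ‖intVec k‖) := by
  set m := d + (n + 1)
  set M := m.factorial * Real.exp c / c ^ m
  refine Summable.of_norm_bounded_eventually ((summable_inv_norm_intVec_pow n).mul_left M) ?_
  have hfin : ({0} : Set (Fin n → ℤ)).Finite := Set.finite_singleton 0
  filter_upwards [hfin.compl_mem_cofinite] with k hk
  have hk0 : 0 < ‖intVec k‖ := by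
    rw [norm_pos_iff]
    intro h
    exact hk (intVec_injective (h.trans (by ext; simp [intVec])))
  set t := ‖intVec k‖
  -- A single term of the exponential series, of degree `m = d + (n + 1)`, pays for the weight of
  -- degree `d` and leaves the summable power `n + 1`.
  have h1 := Real.pow_div_factorial_le_exp (c * (1 + t)) (by positivity) m
  rw [Real.norm_of_nonneg (by positivity), inv_pow, ← div_eq_mul_inv, le_div_iff₀ (by positivity),
    le_div_iff₀ (by positivity)]
  rw [div_le_iff₀ (by positivity), mul_pow, mul_add, mul_one, Real.exp_add] at h1
  have h2 : t ^ (n + 1) ≤ (1 + t) ^ (n + 1) := by gcongr; linarith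
  have h3 : Real.exp (-c * t) * Real.exp (c * t) = 1 := by
    rw [← Real.exp_add]; simp
  calc (1 + t) ^ d * Real.exp (-c * t) * t ^ (n + 1) * c ^ m
      ≤ (1 + t) ^ d * Real.exp (-c * t) * (1 + t) ^ (n + 1) * c ^ m := by gcongr
    _ = Real.exp (-c * t) * (c ^ m * (1 + t) ^ m) := by rw [pow_add (1 + t)]; ring
    _ ≤ Real.exp (-c * t) * (Real.exp c * Real.exp (c * t) * m.factorial) := by gcongr
    _ = m.factorial * Real.exp c := by linear_combination (m.factorial * Real.exp c) * h3

theorem re_modeForm {n : ℕ} (N : ℕ) (Z : (Fin n → ℝ) → Siegel n) (k : Fin n → ℤ) (p : Cov n)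
    (v : Fin n → ℝ) : (modeForm N Z k p (v, 0)).re
      = 2 * Real.pi * (v ⬝ᵥ omIm (Z p.1) *ᵥ (intVec k - (N : ℝ) • p.1)) := by
  rw [modeForm_apply]
  have : (2 * Real.pi * Complex.I : ℂ) = ((2 * Real.pi : ℝ) : ℂ) * Complex.I := by push_cast; ring
  rw [this, mul_assoc, Complex.re_ofReal_mul, Complex.I_mul_re, Complex.im_sum,
    ← Finset.sum_neg_distrib]
  congr 1
  refine Finset.sum_congr rfl fun j _ => ?_
  simp only [Pi.zero_apply, Complex.ofReal_zero, mul_zero, zero_sub, Complex.neg_im, neg_neg,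
    Complex.im_mul_ofReal, bsForm, Complex.im_sum]
  rw [mul_comm]
  congr 1
  refine Finset.sum_congr rfl fun l _ => ?_
  have : ((k l : ℂ) - N * (p.1 l : ℂ)) = (((intVec k - (N : ℝ) • p.1) l : ℝ) : ℂ) := by
    simp [intVec]
  rw [this, Complex.im_mul_ofReal, OmegaM_apply]
  simp

theorem continuous_omIm {n : ℕ} {Z : (Fin n → ℝ) → Siegel n} (hZ : SmoothSiegel Z) :
    Continuous fun x => omIm (Z x) :=
  continuous_matrix fun i j => (contDiff_omIm hZ i j).continuous

/-- A step of length one from `p` in the base direction `k/‖k‖` multiplies `|f|` by at least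
`exp(2π(l‖k‖ - |C₀|))`, since `Im Ω` is positive definite. The endpoint lies in the larger ball,
where `|f| ≤ B`, so `|f p|` is small. The constants do not depend on `k` or `f`. -/
theorem exists_decay {n : ℕ} (N : ℕ) {Z : (Fin n → ℝ) → Siegel n} (hZ : SmoothSiegel Z) (R : ℝ) :
    ∃ c > 0, ∃ C : ℝ, 0 ≤ C ∧ ∀ (k : Fin n → ℤ) (f : Cov n → ℂ), IsMode N Z k f → ∀ B : ℝ,
      (∀ p ∈ Metric.closedBall (0 : Cov n) (R + 1), ‖f p‖ ≤ B) →
        ∀ p ∈ Metric.closedBall (0 : Cov n) R, ‖f p‖ ≤ B * C * Real.exp (-c * ‖intVec k‖) := by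
  set K : Set ((Fin n → ℝ) × (Fin n → ℝ)) :=
    Metric.closedBall 0 (R + 1) ×ˢ Metric.sphere 0 1 with hK
  have hKc : IsCompact K := (isCompact_closedBall _ _).prod (isCompact_sphere _ _)
  have hq : Continuous fun q : (Fin n → ℝ) × (Fin n → ℝ) => q.2 ⬝ᵥ omIm (Z q.1) *ᵥ q.2 :=
    continuous_snd.dotProduct (((continuous_omIm hZ).comp continuous_fst).matrix_mulVec
      continuous_snd)
  have hq' : Continuous fun q : (Fin n → ℝ) × (Fin n → ℝ) =>
      q.2 ⬝ᵥ omIm (Z q.1) *ᵥ ((N : ℝ) • q.1) :=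
    continuous_snd.dotProduct (((continuous_omIm hZ).comp continuous_fst).matrix_mulVec
      (by fun_prop))
  -- `l` is a uniform lower bound of the quadratic form of `Im Ω` on unit vectors; `C₀` below
  -- controls the contribution of `N x`.
  obtain ⟨l, hl, hlK⟩ := hKc.exists_forall_le' hq.continuousOn (a := 0) (by
    rintro ⟨x, v⟩ ⟨-, hv⟩
    have hv0 : v ≠ 0 := by
      rintro rfl
      simp at hv
    simpa using (omIm_posDef (Z x)).dotProduct_mulVec_pos hv0)
  obtain ⟨C₀, hC₀⟩ := hKc.exists_bound_of_continuousOn hq'.continuousOn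
  refine ⟨2 * Real.pi * l, by positivity, Real.exp (2 * Real.pi * |C₀|), (Real.exp_pos _).le, ?_⟩
  intro k f hf B hB p hp
  have hpR : ‖p‖ ≤ R := mem_closedBall_zero_iff.1 hp
  have hB0 : 0 ≤ B := (norm_nonneg _).trans (hB p (by rw [mem_closedBall_zero_iff]; linarith))
  -- For `k = 0` there is no direction to move in, and the bound by `B` is enough because the
  -- constant is at least one.
  by_cases hk : ‖intVec k‖ = 0
  · rw [hk, mul_zero, Real.exp_zero, mul_one]
    refine (hB p (by rw [mem_closedBall_zero_iff]; linarith)).trans ?_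
    exact le_mul_of_one_le_right hB0 (Real.one_le_exp (by positivity))
  set v : Fin n → ℝ := ‖intVec k‖⁻¹ • intVec k with hv
  have hv1 : ‖v‖ = 1 := by rw [hv, norm_smul, norm_inv, norm_norm, inv_mul_cancel₀ hk]
  have hkv : intVec k = ‖intVec k‖ • v := by rw [hv, smul_smul, mul_inv_cancel₀ hk, one_smul]
  have hw : ‖((v, 0) : Cov n)‖ = 1 := by simp [Prod.norm_def, hv1]
  have hpt : ∀ t ∈ Set.Icc (0 : ℝ) 1, ‖p + t • ((v, 0) : Cov n)‖ ≤ R + 1 := by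
    intro t ht
    refine (norm_add_le _ _).trans ?_
    rw [norm_smul, hw, mul_one, Real.norm_of_nonneg ht.1]
    linarith [ht.2]
  have hcont : Continuous fun t : ℝ => modeForm N Z k (p + t • ((v, 0) : Cov n)) (v, 0) := by
    have h1 : Continuous fun t : ℝ => modeForm N Z k (p + t • ((v, 0) : Cov n)) :=
      (contDiff_modeForm N hZ k).continuous.comp (by fun_prop)
    exact h1.clm_apply continuous_const
  have hre : 2 * Real.pi * (l * ‖intVec k‖ - |C₀|)
      ≤ (∫ t in (0 : ℝ)..1, modeForm N Z k (p + t • ((v, 0) : Cov n)) (v, 0)).re := by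
    have h1 : (∫ t in (0 : ℝ)..1, modeForm N Z k (p + t • ((v, 0) : Cov n)) (v, 0)).re
        = ∫ t in (0 : ℝ)..1, (modeForm N Z k (p + t • ((v, 0) : Cov n)) (v, 0)).re :=
      (Complex.reCLM.intervalIntegral_comp_comm (hcont.intervalIntegrable _ _)).symm
    rw [h1]
    have h2 : ∫ _ in (0 : ℝ)..1, 2 * Real.pi * (l * ‖intVec k‖ - |C₀|)
        = 2 * Real.pi * (l * ‖intVec k‖ - |C₀|) := by simp
    rw [← h2]
    refine intervalIntegral.integral_mono_on zero_le_one (by simp)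
      ((Complex.continuous_re.comp hcont).intervalIntegrable _ _) fun t ht => ?_
    rw [re_modeForm]
    set x := (p + t • ((v, 0) : Cov n)).1
    have hx : (x, v) ∈ K := by
      refine ⟨?_, by simpa using hv1⟩
      rw [mem_closedBall_zero_iff]
      exact (norm_fst_le (p + t • ((v, 0) : Cov n))).trans (hpt t ht)
    have h3 := hlK _ hx
    have h4 := (le_abs_self _).trans ((hC₀ _ hx).trans (le_abs_self _))
    simp only at h3 h4
    rw [Matrix.mulVec_sub, dotProduct_sub]
    conv_rhs => rw [hkv, Matrix.mulVec_smul, dotProduct_smul, smul_eq_mul]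
    rw [mul_comm l]
    gcongr
  have h1 := congrArg norm (hf.add_eq hZ p (v, 0))
  rw [norm_mul, Complex.norm_exp] at h1
  have h2 : ‖f (p + (v, 0))‖ ≤ B := by
    refine hB _ ?_
    rw [mem_closedBall_zero_iff]
    simpa using hpt 1 (by simp)
  have h3 : ‖f p‖ * Real.exp (2 * Real.pi * (l * ‖intVec k‖ - |C₀|)) ≤ B := by
    refine le_trans ?_ (h1.symm.le.trans h2)
    gcongr
  have h4 : Real.exp (2 * Real.pi * (l * ‖intVec k‖ - |C₀|)) * (Real.exp (2 * Real.pi * |C₀|)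
      * Real.exp (-(2 * Real.pi * l) * ‖intVec k‖)) = 1 := by
    rw [← Real.exp_add, ← Real.exp_add, ← Real.exp_zero]
    congr 1
    ring
  calc ‖f p‖ = ‖f p‖ * Real.exp (2 * Real.pi * (l * ‖intVec k‖ - |C₀|))
        * (Real.exp (2 * Real.pi * |C₀|) * Real.exp (-(2 * Real.pi * l) * ‖intVec k‖)) := by
        rw [mul_assoc, h4, mul_one]
    _ ≤ B * (Real.exp (2 * Real.pi * |C₀|) * Real.exp (-(2 * Real.pi * l) * ‖intVec k‖)) := by
        gcongr
    _ = _ := by ring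

/-! ### Series of modes -/

/-- The coefficient of `k_l` in `modeForm N Z k`. -/
def modeCoeff {n : ℕ} (Z : (Fin n → ℝ) → Siegel n) (l : Fin n) (p : Cov n) : Cov n →L[ℝ] ℂ :=
  (2 * Real.pi * Complex.I : ℂ) • (dyL l - ∑ j, OmegaM (Z p.1) j l • dxL j)

theorem contDiff_modeCoeff {n : ℕ} {Z : (Fin n → ℝ) → Siegel n} (hZ : SmoothSiegel Z)
    (l : Fin n) : ContDiff ℝ ∞ (modeCoeff Z l) := by
  refine ContDiff.const_smul _ (contDiff_const.sub (ContDiff.sum fun j _ => ?_))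
  exact ((contDiff_OmegaM hZ j l).comp contDiff_fst).smul contDiff_const

/-- The form is affine in `k` with smooth coefficients, so each derivative of a series of modes
costs only one power of `k`. -/
theorem modeForm_eq_sum {n : ℕ} (N : ℕ) (Z : (Fin n → ℝ) → Siegel n) (k : Fin n → ℤ)
    (p : Cov n) : modeForm N Z k p = ∑ l, (k l : ℂ) • modeCoeff Z l p + modeForm N Z 0 p := by
  refine ContinuousLinearMap.ext fun v => ?_
  have h1 : ∀ k : Fin n → ℤ, modeForm N Z k p v = 2 * Real.pi * Complex.I *
      (∑ l, (k l : ℂ) * (v.2 l - ∑ j, OmegaM (Z p.1) j l * (v.1 j : ℂ))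
        + ∑ j, ∑ l, OmegaM (Z p.1) j l * (N * p.1 l) * (v.1 j : ℂ)) := by
    intro k
    rw [modeForm_apply]
    congr 1
    simp only [bsForm, mul_sub, Finset.sum_sub_distrib, sub_mul, Finset.sum_mul, Finset.mul_sum]
    rw [Finset.sum_comm (f := fun l j => (k l : ℂ) * (OmegaM (Z p.1) j l * (v.1 j : ℂ)))]
    have : ∀ j l, OmegaM (Z p.1) j l * (k l : ℂ) * (v.1 j : ℂ)
        = (k l : ℂ) * (OmegaM (Z p.1) j l * (v.1 j : ℂ)) := fun j l => by ring
    simp only [this]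
    ring
  have h2 : ∀ l, modeCoeff Z l p v = 2 * Real.pi * Complex.I *
      (v.2 l - ∑ j, OmegaM (Z p.1) j l * (v.1 j : ℂ)) := by
    intro l
    simp [modeCoeff]
  simp only [add_apply, sum_apply, smul_apply, h1, h2, smul_eq_mul, Pi.zero_apply, Int.cast_zero,
    zero_mul, Finset.sum_const_zero, zero_add, mul_add]
  congr 1
  rw [Finset.mul_sum]
  exact Finset.sum_congr rfl fun l _ => by ring

/-- A locally uniformly bounded family of modes with pairwise different weights. -/
structure IsModeFamily {n : ℕ} {ι : Type*} (N : ℕ) (Z : (Fin n → ℝ) → Siegel n)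
    (wt : ι → Fin n → ℤ) (f : ι → Cov n → ℂ) : Prop where
  injective : Function.Injective wt
  isMode : ∀ i, IsMode N Z (wt i) (f i)
  bounded : ∀ R : ℝ, ∃ B, ∀ i, ∀ p ∈ Metric.closedBall (0 : Cov n) R, ‖f i p‖ ≤ B

namespace IsModeFamily

variable {n N : ℕ} {ι : Type*} {Z : (Fin n → ℝ) → Siegel n} {wt : ι → Fin n → ℤ}
  {f : ι → Cov n → ℂ}

/-- Uniform boundedness on the ball of radius `R + 1` becomes exponential decay on radius `R`;
distinct weights make the majorant a subseries of a convergent lattice sum. -/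
theorem exists_summable_bound (hZ : SmoothSiegel Z) (hf : IsModeFamily N Z wt f) (R : ℝ) (d : ℕ) :
    ∃ u : ι → ℝ, Summable u ∧ ∀ i, ∀ p ∈ Metric.closedBall (0 : Cov n) R,
      (1 + ‖intVec (wt i)‖) ^ d * ‖f i p‖ ≤ u i := by
  obtain ⟨c, hc, C, -, h⟩ := exists_decay N hZ R
  obtain ⟨B, hB⟩ := hf.bounded (R + 1)
  refine ⟨fun i => B * C * ((1 + ‖intVec (wt i)‖) ^ d * Real.exp (-c * ‖intVec (wt i)‖)),
    ((summable_pow_mul_exp_neg_norm_intVec n d hc).comp_injective hf.injective).mul_left _, ?_⟩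
  intro i p hp
  calc (1 + ‖intVec (wt i)‖) ^ d * ‖f i p‖
      ≤ (1 + ‖intVec (wt i)‖) ^ d * (B * C * Real.exp (-c * ‖intVec (wt i)‖)) := by
        gcongr
        exact h _ _ (hf.isMode i) B (hB i) p hp
    _ = _ := by ring

variable {a : ι → ℂ} {A : ℝ} {d : ℕ}

theorem exists_summable_bound_mul (hZ : SmoothSiegel Z) (hf : IsModeFamily N Z wt f)
    (ha : ∀ i, ‖a i‖ ≤ A * (1 + ‖intVec (wt i)‖) ^ d) (R : ℝ) :
    ∃ u : ι → ℝ, Summable u ∧ ∀ i, ∀ p ∈ Metric.closedBall (0 : Cov n) R, ‖a i * f i p‖ ≤ u i := by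
  obtain ⟨u, hu, h⟩ := hf.exists_summable_bound hZ R d
  refine ⟨fun i => |A| * u i, hu.mul_left _, fun i p hp => ?_⟩
  rw [norm_mul]
  calc ‖a i‖ * ‖f i p‖ ≤ |A| * (1 + ‖intVec (wt i)‖) ^ d * ‖f i p‖ := by
        gcongr
        refine (ha i).trans ?_
        gcongr
        exact le_abs_self A
    _ ≤ |A| * u i := by
        rw [mul_assoc]
        gcongr
        exact h i p hp

theorem summable_mul (hZ : SmoothSiegel Z) (hf : IsModeFamily N Z wt f)
    (ha : ∀ i, ‖a i‖ ≤ A * (1 + ‖intVec (wt i)‖) ^ d) (p : Cov n) :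
    Summable fun i => a i * f i p := by
  obtain ⟨u, hu, h⟩ := hf.exists_summable_bound_mul hZ ha ‖p‖
  exact .of_norm_bounded hu fun i => h i p (by simp)

theorem norm_mul_weight_le (ha : ∀ i, ‖a i‖ ≤ A * (1 + ‖intVec (wt i)‖) ^ d) (l : Fin n) (i : ι) :
    ‖a i * (wt i l : ℂ)‖ ≤ A * (1 + ‖intVec (wt i)‖) ^ (d + 1) := by
  have h1 : ‖(wt i l : ℂ)‖ ≤ 1 + ‖intVec (wt i)‖ := by
    have := abs_le_norm_intVec (wt i) l
    rw [Complex.norm_intCast]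
    linarith
  rw [norm_mul, pow_succ, ← mul_assoc]
  exact mul_le_mul (ha i) h1 (norm_nonneg _) ((norm_nonneg _).trans (ha i))

theorem hasSum_smul_modeForm (hZ : SmoothSiegel Z) (hf : IsModeFamily N Z wt f)
    (ha : ∀ i, ‖a i‖ ≤ A * (1 + ‖intVec (wt i)‖) ^ d) (p : Cov n) :
    HasSum (fun i => (a i * f i p) • modeForm N Z (wt i) p)
      (∑ l, (∑' i, a i * (wt i l : ℂ) * f i p) • modeCoeff Z l p
        + (∑' i, a i * f i p) • modeForm N Z 0 p) := by
  have h1 : ∀ l, HasSum (fun i => (a i * (wt i l : ℂ) * f i p) • modeCoeff Z l p)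
      ((∑' i, a i * (wt i l : ℂ) * f i p) • modeCoeff Z l p) := fun l =>
    (hf.summable_mul hZ (norm_mul_weight_le ha l) p).hasSum.smul_const _
  have h2 := (hasSum_sum fun l (_ : l ∈ Finset.univ) => h1 l).add
    ((hf.summable_mul hZ ha p).hasSum.smul_const (modeForm N Z 0 p))
  convert! h2 using 2 with i
  rw [modeForm_eq_sum, smul_add, Finset.smul_sum]
  congr 1
  refine Finset.sum_congr rfl fun l _ => ?_
  rw [smul_smul]
  congr 1
  ring

/-- Coefficients of polynomial growth are allowed because differentiation multiplies them by
components of the weights. -/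
theorem hasFDerivAt_tsum (hZ : SmoothSiegel Z) (hf : IsModeFamily N Z wt f)
    (ha : ∀ i, ‖a i‖ ≤ A * (1 + ‖intVec (wt i)‖) ^ d) (p : Cov n) :
    HasFDerivAt (fun p => ∑' i, a i * f i p)
      (∑' i, (a i * f i p) • modeForm N Z (wt i) p) p := by
  set R := ‖p‖ + 1
  have hpos : 0 < R := add_pos_of_nonneg_of_pos (norm_nonneg p) one_pos
  have hbd : ∀ L : Cov n → Cov n →L[ℝ] ℂ, ContDiff ℝ ∞ L → ∃ M : ℝ, 0 ≤ M ∧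
      ∀ q ∈ Metric.closedBall (0 : Cov n) R, ‖L q‖ ≤ M := by
    intro L hL
    obtain ⟨M, hM⟩ := (isCompact_closedBall (0 : Cov n) R).exists_bound_of_continuousOn
      hL.continuous.continuousOn
    exact ⟨M, (norm_nonneg _).trans (hM 0 (Metric.mem_closedBall_self hpos.le)), hM⟩
  choose M hM0 hM using fun l => hbd _ (contDiff_modeCoeff hZ l)
  obtain ⟨M', hM'0, hM'⟩ := hbd _ (contDiff_modeForm N hZ 0)
  choose u hu hub using fun l => hf.exists_summable_bound_mul hZ (norm_mul_weight_le ha l) R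
  obtain ⟨u', hu', hub'⟩ := hf.exists_summable_bound_mul hZ ha R
  have hsum : Summable fun i => ∑ l, u l i * M l + u' i * M' :=
    (summable_sum fun l _ => (hu l).mul_right _).add (hu'.mul_right _)
  have hd : ∀ i q, q ∈ Metric.ball (0 : Cov n) R →
      HasFDerivAt (fun q => a i * f i q) ((a i * f i q) • modeForm N Z (wt i) q) q := by
    intro i q _
    have := (hf.isMode i q).const_mul (a i)
    rwa [smul_smul] at this
  have hle : ∀ i q, q ∈ Metric.ball (0 : Cov n) R →
      ‖(a i * f i q) • modeForm N Z (wt i) q‖ ≤ ∑ l, u l i * M l + u' i * M' := by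
    intro i q hq
    have hq' := Metric.ball_subset_closedBall hq
    rw [modeForm_eq_sum, smul_add, Finset.smul_sum]
    refine (norm_add_le _ _).trans (add_le_add ((norm_sum_le _ _).trans
      (Finset.sum_le_sum fun l _ => ?_)) ?_)
    · have h1 := hub l i q hq'
      have h2 : a i * f i q * (wt i l : ℂ) = a i * (wt i l : ℂ) * f i q := by ring
      rw [smul_smul, norm_smul, h2]
      exact mul_le_mul h1 (hM l q hq') (norm_nonneg _) ((norm_nonneg _).trans h1)
    · have h1 := hub' i q hq'
      rw [norm_smul]
      exact mul_le_mul h1 (hM' q hq') (norm_nonneg _) ((norm_nonneg _).trans h1)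
  have hp : p ∈ Metric.ball (0 : Cov n) R := by
    rw [mem_ball_zero_iff]
    exact lt_add_one _
  exact hasFDerivAt_tsum_of_isPreconnected (f := fun i q => a i * f i q) hsum
    Metric.isOpen_ball (convex_ball _ _).isPreconnected hd hle hp (hf.summable_mul hZ ha p) hp

theorem contDiff_tsum_mul (hZ : SmoothSiegel Z) (hf : IsModeFamily N Z wt f) (r : ℕ) :
    -- The induction quantifies over `a` and `d`, since the derivative is built from series of the
    -- same kind with degree `d + 1`.
    ∀ {a : ι → ℂ} {d : ℕ}, (∀ i, ‖a i‖ ≤ A * (1 + ‖intVec (wt i)‖) ^ d) →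
      ContDiff ℝ r fun p => ∑' i, a i * f i p := by
  induction r with
  | zero =>
    intro a d ha
    exact contDiff_zero.2 (continuous_iff_continuousAt.2 fun p =>
      (hf.hasFDerivAt_tsum hZ ha p).continuousAt)
  | succ r ih =>
    intro a d ha
    have e : ((r + 1 : ℕ) : WithTop ℕ∞) = (r : WithTop ℕ∞) + 1 := by simp
    have hr : (r : WithTop ℕ∞) ≤ ∞ := by exact_mod_cast le_top
    rw [e, contDiff_succ_iff_hasFDerivAt]
    refine ⟨_, ?_, hf.hasFDerivAt_tsum hZ ha⟩
    have : (fun p => ∑' i, (a i * f i p) • modeForm N Z (wt i) p) = fun p =>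
        ∑ l, (∑' i, a i * (wt i l : ℂ) * f i p) • modeCoeff Z l p
        + (∑' i, a i * f i p) • modeForm N Z 0 p :=
      funext fun p => (hf.hasSum_smul_modeForm hZ ha p).tsum_eq
    rw [this]
    refine (ContDiff.sum fun l _ => ?_).add ((ih ha).smul ((contDiff_modeForm N hZ 0).of_le hr))
    exact (ih (norm_mul_weight_le ha l)).smul ((contDiff_modeCoeff hZ l).of_le hr)

theorem norm_one_le (i : ι) : ‖(fun _ : ι => (1 : ℂ)) i‖ ≤ 1 * (1 + ‖intVec (wt i)‖) ^ 0 := by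
  simp

theorem contDiff_tsum (hZ : SmoothSiegel Z) (hf : IsModeFamily N Z wt f) :
    ContDiff ℝ ∞ fun p => ∑' i, f i p := by
  rw [contDiff_infty]
  intro r
  simpa using hf.contDiff_tsum_mul hZ r norm_one_le

theorem summable (hZ : SmoothSiegel Z) (hf : IsModeFamily N Z wt f) (p : Cov n) :
    Summable fun i => f i p := by
  simpa using hf.summable_mul hZ norm_one_le p

theorem isHolomorphic_tsum (hZ : SmoothSiegel Z) (hf : IsModeFamily N Z wt f) :
    IsHolomorphic N Z fun p => ∑' i, f i p := by
  intro p v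
  have h1 := hf.hasFDerivAt_tsum hZ norm_one_le p
  have h2 := (hf.hasSum_smul_modeForm hZ norm_one_le p).summable.hasSum
  simp only [one_mul] at h1 h2
  have h3 : ∀ w, HasSum (fun i => nabla N (f i) p w) (nabla N (fun p => ∑' i, f i p) p w) := by
    intro w
    have h4 := (ContinuousLinearMap.apply ℝ ℂ w).hasSum h2
    have h5 := (hf.summable hZ p).hasSum.mul_left
      (2 * Real.pi * Complex.I * N * ((p.1 ⬝ᵥ w.2 : ℝ) : ℂ))
    have h6 := h4.sub h5
    simp only [nabla, h1.fderiv, (hf.isMode _ p).fderiv]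
    exact h6
  have h7 := (h3 v).add ((h3 (cplxJ (Z p.1) v)).mul_left Complex.I)
  refine h7.unique ?_
  convert! hasSum_zero with i
  exact (isMode_iff.1 (hf.isMode i)).2.1 p v

end IsModeFamily

theorem IsMode.periodic {n N : ℕ} {Z : (Fin n → ℝ) → Siegel n} {k : Fin n → ℤ} {f : Cov n → ℂ}
    (hZ : SmoothSiegel Z) (hf : IsMode N Z k f) : PeriodicInFibre f := by
  intro p h
  rw [hf.translate hZ]
  have : (2 * Real.pi * Complex.I * ∑ j, (k j : ℂ) * intVec h j : ℂ)
      = ((∑ j, k j * h j : ℤ) : ℂ) * (2 * Real.pi * Complex.I) := by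
    simp [intVec, mul_comm]
  rw [this, Complex.exp_int_mul_two_pi_mul_I, mul_one]

theorem IsModeFamily.isSection_tsum {n N : ℕ} {ι : Type*} {Z : (Fin n → ℝ) → Siegel n}
    {wt : ι → Fin n → ℤ} {f : ι → Cov n → ℂ} (hZ : SmoothSiegel Z) (hf : IsModeFamily N Z wt f) :
    IsSection fun p => ∑' i, f i p :=
  ⟨hf.contDiff_tsum hZ, fun p k => tsum_congr fun i => (hf.isMode i).periodic hZ p k⟩

open MeasureTheory

/-! ### Fourier components in the fibres -/

/-- The character `exp(2π√-1 k·h)`. -/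
def character {n : ℕ} (k : Fin n → ℤ) (h : Fin n → ℝ) : ℂ :=
  Complex.exp (2 * Real.pi * Complex.I * ∑ j, (k j : ℂ) * h j)

theorem character_add {n : ℕ} (k : Fin n → ℤ) (h h' : Fin n → ℝ) :
    character k (h + h') = character k h * character k h' := by
  rw [character, character, character, ← Complex.exp_add, ← mul_add, ← Finset.sum_add_distrib]
  simp [mul_add]

theorem character_neg_mul {n : ℕ} (k : Fin n → ℤ) (h : Fin n → ℝ) :
    character (-k) h * character k h = 1 := by
  rw [character, character, ← Complex.exp_add, ← mul_add, ← Finset.sum_add_distrib]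
  simp

theorem character_neg_add_cancel {n : ℕ} (k : Fin n → ℤ) (h h' : Fin n → ℝ) :
    character k h * character (-k) (h' + h) = character (-k) h' := by
  rw [character_add, mul_left_comm, mul_comm (character k h), character_neg_mul, mul_one]

theorem norm_character {n : ℕ} (k : Fin n → ℤ) (h : Fin n → ℝ) : ‖character k h‖ = 1 := by
  have : (2 * Real.pi * Complex.I * ∑ j, (k j : ℂ) * h j : ℂ)
      = ((2 * Real.pi * ∑ j, k j * h j : ℝ) : ℂ) * Complex.I := by
    push_cast; ring
  rw [character, this, Complex.norm_exp_ofReal_mul_I]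

theorem continuous_character {n : ℕ} (k : Fin n → ℤ) : Continuous (character k) := by
  unfold character
  fun_prop

theorem mFourier_mk {n : ℕ} (k : Fin n → ℤ) (h : Fin n → ℝ) :
    UnitAddTorus.mFourier k (fun i => (h i : UnitAddCircle)) = character k h := by
  simp only [UnitAddTorus.mFourier, ContinuousMap.coe_mk, fourier_coe_apply, character,
    Finset.mul_sum, Complex.exp_sum]
  refine Finset.prod_congr rfl fun i _ => ?_
  congr 1
  simp
  ring

/-- The half-open unit box with lower corner `a`. -/
def unitBox {n : ℕ} (a : Fin n → ℝ) : Set (Fin n → ℝ) := {x | ∀ i, x i ∈ Set.Ioc (a i) (a i + 1)}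

theorem unitBox_eq_pi {n : ℕ} (a : Fin n → ℝ) :
    unitBox a = Set.univ.pi fun i => Set.Ioc (a i) (a i + 1) := by
  ext x; simp [unitBox]

theorem measurableSet_unitBox {n : ℕ} (a : Fin n → ℝ) : MeasurableSet (unitBox a) := by
  rw [unitBox_eq_pi]
  exact MeasurableSet.univ_pi fun i => measurableSet_Ioc

theorem volume_unitBox {n : ℕ} (a : Fin n → ℝ) : volume (unitBox a) = 1 := by
  rw [unitBox_eq_pi, Real.volume_pi_Ioc]
  simp

theorem volume_real_unitBox {n : ℕ} (a : Fin n → ℝ) : volume.real (unitBox a) = 1 := by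
  simp [Measure.real, volume_unitBox]

theorem unitBox_subset {n : ℕ} : unitBox (0 : Fin n → ℝ) ⊆ Set.Icc 0 1 := by
  intro x hx
  exact ⟨fun i => (hx i).1.le, fun i => by simpa using (hx i).2⟩

theorem norm_le_of_mem_Icc {n : ℕ} {h : Fin n → ℝ} (hh : h ∈ Set.Icc (0 : Fin n → ℝ) 1) :
    ‖((0, h) : Cov n)‖ ≤ 1 := by
  have : ‖h‖ ≤ 1 := by
    rw [pi_norm_le_iff_of_nonneg zero_le_one]
    intro i
    rw [Real.norm_of_nonneg (hh.1 i)]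
    exact hh.2 i
  simpa [Prod.norm_def] using this

theorem integrableOn_unitBox {n : ℕ} {E : Type*} [NormedAddCommGroup E]
    {φ : (Fin n → ℝ) → E} (hφ : ContinuousOn φ (Set.Icc 0 1)) :
    IntegrableOn φ (unitBox 0) :=
  (hφ.integrableOn_compact isCompact_Icc).mono_set unitBox_subset

/-- The component of weight `k` of `s` under translations in the fibres. -/
def component {n : ℕ} (k : Fin n → ℤ) (s : Cov n → ℂ) (p : Cov n) : ℂ :=
  ∫ h in unitBox 0, character (-k) h * s (p + (0, h))

theorem norm_component_le {n : ℕ} (k : Fin n → ℤ) {s : Cov n → ℂ} {p : Cov n} {B : ℝ}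
    (hB : ∀ h ∈ Set.Icc (0 : Fin n → ℝ) 1, ‖s (p + (0, h))‖ ≤ B) : ‖component k s p‖ ≤ B := by
  have := norm_setIntegral_le_of_norm_le_const (μ := volume) (s := unitBox (0 : Fin n → ℝ))
    (f := fun h => character (-k) h * s (p + (0, h))) (C := B)
    (by rw [volume_unitBox]; exact ENNReal.one_lt_top) (fun h hh => by
      rw [norm_mul, norm_character, one_mul]
      exact hB h (unitBox_subset hh))
  rwa [volume_real_unitBox, mul_one] at this

/-- The function on the fibre torus over `x` induced by a continuous periodic function. -/
theorem exists_torus_fun {n : ℕ} {s : Cov n → ℂ} (hc : Continuous s) (hs : PeriodicInFibre s)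
    (x : Fin n → ℝ) : ∃ G : C(UnitAddTorus (Fin n), ℂ),
      ∀ y : Fin n → ℝ, G (fun i => (y i : UnitAddCircle)) = s (x, y) := by
  have hq : Topology.IsQuotientMap
      (Pi.map fun (_ : Fin n) (t : ℝ) => (t : UnitAddCircle)) :=
    (IsOpenQuotientMap.piMap fun _ => QuotientAddGroup.isOpenQuotientMap_mk).isQuotientMap
  let π : C(Fin n → ℝ, UnitAddTorus (Fin n)) :=
    ⟨Pi.map fun (_ : Fin n) (t : ℝ) => (t : UnitAddCircle), hq.continuous⟩
  let g : C(Fin n → ℝ, ℂ) := ⟨fun y => s (x, y), by fun_prop⟩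
  have hfac : Function.FactorsThrough g π := by
    intro y y' h
    have h1 : ∀ i, ∃ k : ℤ, y' i = y i + k := by
      intro i
      have h2 : ((y i : ℝ) : UnitAddCircle) = (y' i : ℝ) := congrFun h i
      rw [← sub_eq_zero, ← AddCircle.coe_sub, AddCircle.coe_eq_zero_iff] at h2
      obtain ⟨j, hj⟩ := h2
      refine ⟨-j, ?_⟩
      simp only [zsmul_eq_mul, mul_one] at hj
      push_cast
      linarith
    choose k hk using h1
    have : y' = y + intVec k := funext hk
    rw [this]
    exact (hs (x, y) k).symm
  exact ⟨Topology.IsQuotientMap.lift (f := π) hq g hfac, fun y =>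
    DFunLike.congr_fun (Topology.IsQuotientMap.lift_comp (f := π) hq g hfac) y⟩

/-- The Fourier coefficient can be computed on any unit box, in particular on the one with corner
`y`; translating that box to the origin produces the character. -/
theorem component_eq_mFourierCoeff {n : ℕ} {s : Cov n → ℂ} {x : Fin n → ℝ}
    {G : C(UnitAddTorus (Fin n), ℂ)}
    (hG : ∀ y : Fin n → ℝ, G (fun i => (y i : UnitAddCircle)) = s (x, y)) (k : Fin n → ℤ)
    (y : Fin n → ℝ) :
    component k s (x, y) = UnitAddTorus.mFourierCoeff G k * character k y := by
  have h1 := (measurePreserving_add_right (volume : Measure (Fin n → ℝ)) y).setIntegral_preimage_emb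
    (measurableEmbedding_addRight y) (fun h => character (-k) h * s (x, h)) (unitBox y)
  have h2 : (fun h => h + y) ⁻¹' unitBox y = unitBox (0 : Fin n → ℝ) := by
    ext h
    simp [unitBox, add_comm (y _) 1]
  rw [h2] at h1
  rw [UnitAddTorus.mFourierCoeff_eq_integral _ _ y, component]
  simp only [mFourier_mk, hG, smul_eq_mul]
  change _ = (∫ h in unitBox y, character (-k) h * s (x, h)) * _
  rw [← h1, ← integral_mul_const]
  refine integral_congr_ae (.of_forall fun h => ?_)
  simp only [Prod.mk_add_mk, add_zero]
  rw [add_comm y h, mul_right_comm, mul_comm (character (-k) (h + y)), character_neg_add_cancel]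

theorem component_translate {n : ℕ} {s : Cov n → ℂ} (hc : Continuous s) (hs : PeriodicInFibre s)
    (k : Fin n → ℤ) (x y t : Fin n → ℝ) :
    component k s (x, y + t) = component k s (x, y) * character k t := by
  obtain ⟨G, hG⟩ := exists_torus_fun hc hs x
  rw [component_eq_mFourierCoeff hG, component_eq_mFourierCoeff hG, character_add, mul_assoc]

theorem hasSum_component {n : ℕ} {s : Cov n → ℂ} (hc : Continuous s) (hs : PeriodicInFibre s)
    (p : Cov n) (hsum : Summable fun k => component k s p) :
    HasSum (fun k => component k s p) (s p) := by
  obtain ⟨G, hG⟩ := exists_torus_fun hc hs p.1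
  have h1 : ∀ k, component k s p = UnitAddTorus.mFourierCoeff G k * character k p.2 := fun k =>
    component_eq_mFourierCoeff hG k p.2
  have h2 : Summable (UnitAddTorus.mFourierCoeff G) := by
    refine Summable.of_norm ?_
    have := hsum.norm
    simpa only [h1, norm_mul, norm_character, mul_one] using this
  have h3 := UnitAddTorus.hasSum_mFourier_series_apply_of_summable h2
    (fun i => (p.2 i : UnitAddCircle))
  simp only [mFourier_mk, hG, smul_eq_mul] at h3
  simpa only [h1] using h3

theorem hasFDerivAt_component {n : ℕ} (k : Fin n → ℤ) {s : Cov n → ℂ} (hs : ContDiff ℝ ∞ s)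
    (p : Cov n) : HasFDerivAt (component k s)
      (∫ h in unitBox 0, character (-k) h • fderiv ℝ s (p + (0, h))) p := by
  have hfc : Continuous (fderiv ℝ s) := hs.continuous_fderiv (by simp)
  -- One unit for the ball around `p` and one for the translation by the box.
  obtain ⟨M, hM⟩ := (isCompact_closedBall (0 : Cov n) (‖p‖ + 2)).exists_bound_of_continuousOn
    hfc.continuousOn
  have hcont : ∀ q : Cov n, Continuous fun h => character (-k) h * s (q + (0, h)) := fun q =>
    (continuous_character _).mul (hs.continuous.comp (by fun_prop))
  have hcont' : Continuous fun h => character (-k) h • fderiv ℝ s (p + (0, h)) :=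
    (continuous_character _).smul (hfc.comp (by fun_prop))
  refine hasFDerivAt_integral_of_dominated_of_fderiv_le (bound := fun _ => M)
    (F := fun q h => character (-k) h * s (q + (0, h)))
    (F' := fun q h => character (-k) h • fderiv ℝ s (q + (0, h)))
    (Metric.ball_mem_nhds p one_pos) (.of_forall fun q => (hcont q).aestronglyMeasurable)
    (integrableOn_unitBox (hcont p).continuousOn) hcont'.aestronglyMeasurable ?_
    (integrableOn_unitBox continuousOn_const) ?_
  · filter_upwards [ae_restrict_mem (measurableSet_unitBox 0)] with h hh q hq
    rw [norm_smul, norm_character, one_mul]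
    refine hM _ ?_
    rw [mem_closedBall_zero_iff]
    have h1 := norm_le_of_mem_Icc (unitBox_subset hh)
    have h2 : ‖q‖ ≤ ‖p‖ + 1 := by
      have := norm_add_le (q - p) p
      rw [sub_add_cancel] at this
      have h3 : ‖q - p‖ < 1 := by rwa [← dist_eq_norm]
      linarith
    linarith [norm_add_le q (0, h)]
  · refine .of_forall fun h q _ => ?_
    have h1 : HasFDerivAt (fun q : Cov n => s (q + (0, h))) (fderiv ℝ s (q + (0, h))) q :=
      (hasFDerivAt_comp_add_right (0, h)).2 ((hs.differentiable (by simp)) _).hasFDerivAt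
    exact h1.const_mul _

theorem nabla_component {n : ℕ} (N : ℕ) (k : Fin n → ℤ) {s : Cov n → ℂ} (hs : ContDiff ℝ ∞ s)
    (p v : Cov n) : nabla N (component k s) p v
      = ∫ h in unitBox 0, character (-k) h * nabla N s (p + (0, h)) v := by
  have hfc : Continuous (fderiv ℝ s) := hs.continuous_fderiv (by simp)
  have hcont : Continuous fun h => character (-k) h * s (p + (0, h)) :=
    (continuous_character _).mul (hs.continuous.comp (by fun_prop))
  have hcont' : Continuous fun h => character (-k) h • fderiv ℝ s (p + (0, h)) :=
    (continuous_character _).smul (hfc.comp (by fun_prop))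
  have h1 := integrableOn_unitBox hcont'.continuousOn
  rw [nabla, (hasFDerivAt_component k hs p).fderiv, ContinuousLinearMap.integral_apply h1,
    component, ← integral_const_mul, ← integral_sub]
  · refine integral_congr_ae (.of_forall fun h => ?_)
    simp [nabla]
    ring
  · exact (ContinuousLinearMap.apply ℝ ℂ v).integrable_comp h1
  · exact (integrableOn_unitBox hcont.continuousOn).const_mul _

/-- Translations in the fibre preserve the connection form `x·dy` and `J`, so the holomorphy
equation can be averaged against a character; the weight comes from `component_translate`. -/
theorem isMode_component {n N : ℕ} {Z : (Fin n → ℝ) → Siegel n} {s : Cov n → ℂ}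
    (hs : IsSection s) (hol : IsHolomorphic N Z s) (k : Fin n → ℤ) :
    IsMode N Z k (component k s) := by
  have hd := hasFDerivAt_component k hs.1
  refine isMode_iff.2 ⟨fun p => (hd p).differentiableAt, fun p v => ?_, fun p i => ?_⟩
  · have hfc : Continuous (fderiv ℝ s) := hs.1.continuous_fderiv (by simp)
    have hcont : ∀ v, Continuous fun h => character (-k) h * nabla N s (p + (0, h)) v := by
      intro v
      refine (continuous_character _).mul (((hfc.comp (by fun_prop)).clm_apply
        continuous_const).sub (Continuous.mul ?_ (hs.1.continuous.comp (by fun_prop))))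
      simp only [Prod.fst_add, add_zero]
      exact continuous_const
    rw [nabla_component N k hs.1, nabla_component N k hs.1, ← integral_const_mul, ← integral_add
      (integrableOn_unitBox (hcont _).continuousOn)
      ((integrableOn_unitBox (hcont _).continuousOn).const_mul _)]
    rw [← integral_zero (Fin n → ℝ) ℂ (μ := volume.restrict (unitBox 0))]
    refine integral_congr_ae (.of_forall fun h => ?_)
    have := hol (p + (0, h)) v
    simp only [Prod.fst_add, add_zero] at this ⊢
    linear_combination character (-k) h * this
  · have hline : HasDerivAt (fun t : ℝ => p + t • (ddy i : Cov n)) (ddy i) 0 := by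
      simpa using! ((hasDerivAt_id (0 : ℝ)).smul_const (ddy i : Cov n)).const_add p
    have h1 : HasDerivAt (fun t : ℝ => component k s (p + t • (ddy i : Cov n)))
        (fderiv ℝ (component k s) p (ddy i)) 0 := by
      have h0 : HasFDerivAt (component k s) (fderiv ℝ (component k s) p)
          (p + (0 : ℝ) • (ddy i : Cov n)) := by
        rw [zero_smul, add_zero]
        exact (hd p).differentiableAt.hasFDerivAt
      exact h0.comp_hasDerivAt (0 : ℝ) hline
    have e : (fun t : ℝ => component k s (p + t • (ddy i : Cov n)))
        = fun t : ℝ => component k s p * Complex.exp (2 * Real.pi * Complex.I * k i * t) := by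
      funext t
      have h2 : p + t • (ddy i : Cov n) = (p.1, p.2 + t • Pi.single i 1) := by
        refine Prod.ext ?_ ?_ <;> simp [ddy]
      rw [h2, component_translate hs.1.continuous hs.2, character, Finset.sum_eq_single i]
      · simp [mul_assoc]
      · intro j _ hj; simp [hj]
      · simp
    rw [e] at h1
    have h3 : HasDerivAt (fun t : ℝ => 2 * Real.pi * Complex.I * k i * (t : ℂ))
        (2 * Real.pi * Complex.I * k i) 0 := by
      simpa using! (Complex.ofRealCLM.hasDerivAt (x := 0)).const_mul
        (2 * Real.pi * Complex.I * k i : ℂ)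
    have h4 := (h3.cexp).const_mul (component k s p)
    have := h1.unique h4
    rw [this]
    simp
    ring

theorem isModeFamily_component {n N : ℕ} {Z : (Fin n → ℝ) → Siegel n} {s : Cov n → ℂ}
    (hs : IsSection s) (hol : IsHolomorphic N Z s) :
    IsModeFamily N Z id fun k => component k s where
  injective := Function.injective_id
  isMode k := isMode_component hs hol k
  bounded R := by
    obtain ⟨B, hB⟩ := (isCompact_closedBall (0 : Cov n) (R + 1)).exists_bound_of_continuousOn
      hs.1.continuous.continuousOn
    refine ⟨B, fun k p hp => norm_component_le k fun h hh => hB _ ?_⟩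
    rw [mem_closedBall_zero_iff] at hp ⊢
    linarith [norm_add_le p (0, h), norm_le_of_mem_Icc hh]

/-- The component is a constant multiple of `f`, of weight `l`, and also a mode of weight `k`. If
the weights differ, comparing fibre derivatives forces it to vanish, without evaluating the
integral. -/
theorem component_of_isMode {n N : ℕ} {Z : (Fin n → ℝ) → Siegel n} (hZ : SmoothSiegel Z)
    {l : Fin n → ℤ} {f : Cov n → ℂ} (hf : IsMode N Z l f) (k : Fin n → ℤ) (p : Cov n) :
    component k f p = if k = l then f p else 0 := by
  set c : ℂ := ∫ h in unitBox (0 : Fin n → ℝ), character (-k) h * character l h with hc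
  have hcf : component k f = fun p => c * f p := by
    funext p
    rw [hc, component, ← integral_mul_const]
    refine integral_congr_ae (.of_forall fun h => ?_)
    have h1 : p + (0, h) = (p.1, p.2 + h) := by ext <;> simp
    simp only [h1, hf.translate hZ]
    rw [character, character]
    ring
  split_ifs with hkl
  · subst hkl
    simp only [hcf, hc, character_neg_mul]
    simp [volume_real_unitBox]
  · obtain ⟨i, hi⟩ := Function.ne_iff.1 hkl
    have hm := isMode_iff.1 hf
    have h1 := (isMode_iff.1 (isMode_component ⟨hf.contDiff hZ, hf.periodic hZ⟩ hm.2.1 k)).2.2 p i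
    rw [hcf, fderiv_const_mul (hm.1 p), smul_apply, hm.2.2, smul_eq_mul] at h1
    have h2 : (2 * Real.pi * Complex.I : ℂ) * ((l i : ℂ) - k i) ≠ 0 :=
      mul_ne_zero Complex.two_pi_I_ne_zero
        (sub_ne_zero.2 (by exact_mod_cast Ne.symm hi))
    rw [hcf]
    apply mul_left_cancel₀ h2
    linear_combination h1

theorem hasSum_component_of_tendstoUniformlyOn {n : ℕ} {ι : Type*} {f : ι → Cov n → ℂ}
    {F : Cov n → ℂ} (hf : ∀ i, Continuous (f i))
    (hF : ∀ K : Set (Cov n), IsCompact K → TendstoUniformlyOn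
      (fun (S : Finset ι) p => ∑ i ∈ S, f i p) F Filter.atTop K) (k : Fin n → ℤ) (p : Cov n) :
    HasSum (fun i => component k (f i) p) (component k F p) := by
  set K : Set (Cov n) := (fun h => p + (0, h)) '' Set.Icc (0 : Fin n → ℝ) 1
  have hK : IsCompact K := isCompact_Icc.image (by fun_prop)
  have hmaps : Set.MapsTo (fun h => p + (0, h)) (Set.Icc (0 : Fin n → ℝ) 1) K :=
    Set.mapsTo_image _ _
  have hpc : Continuous fun h : Fin n → ℝ => p + (0, h) := by fun_prop
  have hu := hF K hK
  have hFc : ContinuousOn F K := hu.continuousOn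
    (.of_forall fun S => (continuous_finsetSum S fun i _ => hf i).continuousOn)
  have hint : ∀ φ : Cov n → ℂ, ContinuousOn φ K →
      IntegrableOn (fun h => character (-k) h * φ (p + (0, h))) (unitBox 0) := fun φ hφ =>
    integrableOn_unitBox ((continuous_character _).continuousOn.mul
      (hφ.comp hpc.continuousOn hmaps))
  have hS : ∀ S : Finset ι, ∑ i ∈ S, component k (f i) p
      = component k (fun q => ∑ i ∈ S, f i q) p := by
    intro S
    simp only [component, Finset.mul_sum]
    exact (integral_finsetSum S fun i _ => hint _ (hf i).continuousOn).symm
  rw [HasSum, SummationFilter.unconditional_filter, Metric.tendsto_nhds]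
  intro ε hε
  filter_upwards [Metric.tendstoUniformlyOn_iff.1 hu (ε / 2) (by positivity)] with S hSε
  have h1 : component k F p - ∑ i ∈ S, component k (f i) p
      = component k (fun q => F q - ∑ i ∈ S, f i q) p := by
    rw [hS, component, component, component, ← integral_sub (hint _ hFc)
      (hint _ (continuous_finsetSum S fun i _ => hf i).continuousOn)]
    simp only [mul_sub]
  rw [dist_comm, dist_eq_norm, h1]
  refine (norm_component_le (B := ε / 2) k fun h hh => ?_).trans_lt (by linarith)
  rw [← dist_eq_norm]
  exact (hSε _ (hmaps hh)).le

theorem bsPoint_injective {n N : ℕ} (hN : 0 < N) :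
    Function.Injective (bsPoint N : (Fin n → ℤ) → Fin n → ℝ) := by
  intro k l h
  ext i
  have h1 := congrFun h i
  have hN' : (N : ℝ) ≠ 0 := by exact_mod_cast hN.ne'
  simp only [bsPoint, div_left_inj' hN'] at h1
  exact_mod_cast h1

namespace ActionData

/-! ### The action on sections -/

section

variable {n : ℕ} {Γ : Type*} (d : ActionData n Γ)

theorem AR_transpose_mul_AinvT (γ : Γ) : (d.AR γ)ᵀ * d.AinvT γ = 1 := by
  have h : ((d.A γ)⁻¹).1 * (d.A γ).1 = 1 := (d.A γ).inv_mul
  have h2 := congrArg (fun M : Matrix (Fin n) (Fin n) ℤ => M.map (Int.castRingHom ℝ)) h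
  simp only [Matrix.map_mul] at h2
  rw [AR, AinvT, ← Matrix.transpose_mul]
  change ((((d.A γ)⁻¹).1).map (Int.castRingHom ℝ) * ((d.A γ).1).map (Int.castRingHom ℝ))ᵀ = 1
  rw [h2]
  simp

theorem AinvT_mul_AR_transpose (γ : Γ) : d.AinvT γ * (d.AR γ)ᵀ = 1 :=
  mul_eq_one_comm.1 (d.AR_transpose_mul_AinvT γ)

theorem AR_mulVec_dotProduct (γ : Γ) (x y : Fin n → ℝ) :
    d.AR γ *ᵥ x ⬝ᵥ d.AinvT γ *ᵥ y = x ⬝ᵥ y := by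
  rw [← Matrix.vecMul_transpose, ← Matrix.dotProduct_mulVec, Matrix.mulVec_mulVec,
    AR_transpose_mul_AinvT, Matrix.one_mulVec]

theorem rho_dotProduct (γ : Γ) (x y : Fin n → ℝ) :
    d.rho γ x ⬝ᵥ d.AinvT γ *ᵥ y = x ⬝ᵥ y + d.c γ ⬝ᵥ d.AinvT γ *ᵥ y := by
  rw [rho, add_dotProduct, AR_mulVec_dotProduct]

theorem factor_ne_zero (N : ℕ) (γ : Γ) (p : Cov n) : d.factor N γ p ≠ 0 :=
  mul_ne_zero (by simp) (Complex.exp_ne_zero _)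

/-- The derivative of `ρ̃_γ`. -/
def rhoTDeriv (γ : Γ) (p : Cov n) : Cov n →L[ℝ] Cov n :=
  ((Matrix.mulVecLin (d.AR γ)).toContinuousLinearMap ∘L ContinuousLinearMap.fst ℝ _ _).prod
    ((Matrix.mulVecLin (d.AinvT γ)).toContinuousLinearMap ∘L ContinuousLinearMap.snd ℝ _ _
      + fderiv ℝ (d.u γ) p.1 ∘L ContinuousLinearMap.fst ℝ _ _)

theorem rhoTDeriv_apply (γ : Γ) (p v : Cov n) : d.rhoTDeriv γ p v
    = (d.AR γ *ᵥ v.1, d.AinvT γ *ᵥ v.2 + fderiv ℝ (d.u γ) p.1 v.1) := rfl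

theorem rhoTDeriv_surjective (γ : Γ) (p w : Cov n) : ∃ v, d.rhoTDeriv γ p v = w := by
  have h : d.AR γ * (d.AinvT γ)ᵀ = 1 := by
    rw [← Matrix.transpose_transpose (d.AR γ), ← Matrix.transpose_mul, AinvT_mul_AR_transpose,
      Matrix.transpose_one]
  refine ⟨((d.AinvT γ)ᵀ *ᵥ w.1,
    (d.AR γ)ᵀ *ᵥ (w.2 - fderiv ℝ (d.u γ) p.1 ((d.AinvT γ)ᵀ *ᵥ w.1))), ?_⟩
  rw [rhoTDeriv_apply]
  simp only [Matrix.mulVec_mulVec, h, AinvT_mul_AR_transpose, Matrix.one_mulVec, sub_add_cancel]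

end

variable {n N : ℕ} {Γ : Type*} [Group Γ] {Z : (Fin n → ℝ) → Siegel n} {d : ActionData n Γ}

/-! ### Derivatives of the lifted action -/

namespace IsQuantumAction

variable (hd : d.IsQuantumAction N Z)

include hd

theorem rho_one (x : Fin n → ℝ) : d.rho 1 x = x :=
  (hd.one_act (x, 0)).1.symm

theorem rho_mul (γ₁ γ₂ : Γ) (x : Fin n → ℝ) : d.rho (γ₁ * γ₂) x = d.rho γ₁ (d.rho γ₂ x) :=
  (hd.mul_act γ₁ γ₂ (x, 0)).1.symm

theorem rho_inv_rho (γ : Γ) (x : Fin n → ℝ) : d.rho γ⁻¹ (d.rho γ x) = x := by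
  rw [← hd.rho_mul, inv_mul_cancel, hd.rho_one]

theorem rho_rho_inv (γ : Γ) (x : Fin n → ℝ) : d.rho γ (d.rho γ⁻¹ x) = x := by
  rw [← hd.rho_mul, mul_inv_cancel, hd.rho_one]

theorem differentiable_u (γ : Γ) : Differentiable ℝ (d.u γ) :=
  (hd.smooth γ).differentiable (by simp)

theorem hasFDerivAt_rhoT (γ : Γ) (p : Cov n) : HasFDerivAt (d.rhoT γ) (d.rhoTDeriv γ p) p := by
  refine HasFDerivAt.prodMk ?_ (HasFDerivAt.add ?_ ?_)
  · exact ((Matrix.mulVecLin (d.AR γ)).toContinuousLinearMap ∘L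
      ContinuousLinearMap.fst ℝ (Fin n → ℝ) (Fin n → ℝ)).hasFDerivAt.add_const (d.c γ)
  · exact ((Matrix.mulVecLin (d.AinvT γ)).toContinuousLinearMap ∘L
      ContinuousLinearMap.snd ℝ (Fin n → ℝ) (Fin n → ℝ)).hasFDerivAt
  · exact HasFDerivAt.comp p (hd.differentiable_u γ p.1).hasFDerivAt hasFDerivAt_fst

/-- Preservation of `ω₀`, tested on horizontal vectors, says that the one-form `ᵗA_γ u_γ·dx` is
closed. -/
theorem fderiv_u_symm (γ : Γ) (x v w : Fin n → ℝ) :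
    fderiv ℝ (d.u γ) x v ⬝ᵥ d.AR γ *ᵥ w = fderiv ℝ (d.u γ) x w ⬝ᵥ d.AR γ *ᵥ v := by
  have h := hd.symplectic γ (x, 0) (v, 0) (w, 0)
  rw [(hd.hasFDerivAt_rhoT γ (x, 0)).fderiv, rhoTDeriv_apply, rhoTDeriv_apply, omega0_apply,
    omega0_apply] at h
  simp only [Matrix.mulVec_zero, zero_add, dotProduct_zero, zero_dotProduct, sub_self] at h
  rw [dotProduct_comm (d.AR γ *ᵥ v)] at h
  linarith

/-- The staircase sum in `g̃_γ` is a primitive of `ᵗA_γ u_γ·dx`. It cancels the term of `d(ρ_γ·u_γ)`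
in which `ρ_γ` is differentiated, leaving `ρ_γ·du_γ`. -/
theorem hasFDerivAt_gT (γ : Γ) (x : Fin n → ℝ) : ∃ L : (Fin n → ℝ) →L[ℝ] ℝ,
    HasFDerivAt (d.gT γ) L x ∧ ∀ v, L v = d.rho γ x ⬝ᵥ fderiv ℝ (d.u γ) x v := by
  have hu : ∀ x, HasFDerivAt (d.u γ) (fderiv ℝ (d.u γ) x) x := fun x =>
    (hd.differentiable_u γ x).hasFDerivAt
  have hα : ∀ i x, HasFDerivAt (fun x => ((d.AR γ)ᵀ *ᵥ d.u γ x) i)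
      (ContinuousLinearMap.proj i ∘L (Matrix.mulVecLin (d.AR γ)ᵀ).toContinuousLinearMap ∘L
        fderiv ℝ (d.u γ) x) x := fun i x =>
    (ContinuousLinearMap.proj (R := ℝ) (φ := fun _ : Fin n => ℝ) i ∘L
      (Matrix.mulVecLin (d.AR γ)ᵀ).toContinuousLinearMap).hasFDerivAt.comp x (hu x)
  have hsingle : ∀ (i : Fin n) (w : Fin n → ℝ),
      ((d.AR γ)ᵀ *ᵥ w) i = w ⬝ᵥ d.AR γ *ᵥ Pi.single i 1 := by
    intro i w
    rw [Matrix.mulVec_single_one, dotProduct_comm]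
    rfl
  have h1 := hasFDerivAt_sum_integral_stair (fun i x => (hα i x).differentiableAt)
    (fun i j x => by
      rw [(hα j x).fderiv, (hα i x).fderiv]
      change ((d.AR γ)ᵀ *ᵥ _) j = ((d.AR γ)ᵀ *ᵥ _) i
      rw [hsingle, hsingle]
      exact hd.fderiv_u_symm γ x _ _) 0 x
  have hrho : HasFDerivAt (d.rho γ) (Matrix.mulVecLin (d.AR γ)).toContinuousLinearMap x :=
    (Matrix.mulVecLin (d.AR γ)).toContinuousLinearMap.hasFDerivAt.add_const (d.c γ)
  have h2 : HasFDerivAt (fun x => d.rho γ x ⬝ᵥ d.u γ x) _ x :=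
    HasFDerivAt.fun_sum fun i _ => ((hasFDerivAt_pi'.1 hrho) i).mul ((hasFDerivAt_pi'.1 (hu x)) i)
  refine ⟨_, (h2.sub_const (d.c γ ⬝ᵥ d.u γ 0)).sub h1, fun v => ?_⟩
  simp only [sub_apply, sum_apply, add_apply, smul_apply, ContinuousLinearMap.comp_apply,
    ContinuousLinearMap.proj_apply, ContinuousLinearMap.smulRight_apply, smul_eq_mul,
    Finset.sum_add_distrib]
  have h3 : ∑ i, v i * ((d.AR γ)ᵀ *ᵥ d.u γ x) i = ∑ i, d.u γ x i * (d.AR γ *ᵥ v) i := by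
    change v ⬝ᵥ (d.AR γ)ᵀ *ᵥ d.u γ x = d.u γ x ⬝ᵥ d.AR γ *ᵥ v
    rw [Matrix.dotProduct_mulVec, Matrix.vecMul_transpose, dotProduct_comm]
  rw [h3]
  exact add_sub_cancel_right _ _

theorem hasFDerivAt_factor (γ : Γ) (p : Cov n) : ∃ L : Cov n →L[ℝ] ℂ,
    HasFDerivAt (d.factor N γ) L p ∧ ∀ v, L v = d.factor N γ p * (2 * Real.pi * Complex.I * N *
      ((d.rho γ p.1 ⬝ᵥ fderiv ℝ (d.u γ) p.1 v.1 + d.c γ ⬝ᵥ d.AinvT γ *ᵥ v.2 : ℝ) : ℂ)) := by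
  obtain ⟨L₁, hL₁, hL₁'⟩ := hd.hasFDerivAt_gT γ p.1
  let L₂ : Cov n →L[ℝ] ℝ := (LinearMap.toContinuousLinearMap
    ((dotProductBilin ℝ ℝ (d.c γ)) ∘ₗ (Matrix.mulVecLin (d.AinvT γ)))) ∘L
      ContinuousLinearMap.snd ℝ _ _
  have h1 : HasFDerivAt (fun p : Cov n => d.gT γ p.1 + d.c γ ⬝ᵥ d.AinvT γ *ᵥ p.2)
      (L₁ ∘L ContinuousLinearMap.fst ℝ _ _ + L₂) p :=
    (HasFDerivAt.comp p hL₁ hasFDerivAt_fst).add L₂.hasFDerivAt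
  have h2 := ((((Complex.ofRealCLM.hasFDerivAt.comp p h1).const_mul
    (2 * Real.pi * Complex.I * N : ℂ)).cexp).const_mul (d.g γ : ℂ))
  refine ⟨_, h2, fun v => ?_⟩
  simp only [smul_apply, ContinuousLinearMap.comp_apply, add_apply, smul_eq_mul,
    ContinuousLinearMap.coe_fst', hL₁', Complex.ofRealCLM_apply, Function.comp]
  exact (mul_assoc (d.g γ : ℂ) _ _).symm

end IsQuantumAction

/-- The inverse of `ρ̃_γ`. -/
def invT (d : ActionData n Γ) (γ : Γ) (q : Cov n) : Cov n :=
  (d.rho γ⁻¹ q.1, (d.AR γ)ᵀ *ᵥ (q.2 - d.u γ (d.rho γ⁻¹ q.1)))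

/-- The action of `γ` on functions that is induced by the lift of `ρ̃_γ`. -/
def transport (d : ActionData n Γ) (N : ℕ) (γ : Γ) (f : Cov n → ℂ) (q : Cov n) : ℂ :=
  d.factor N γ (d.invT γ q) * f (d.invT γ q)

/-- The action of `γ` on weights. -/
def IsQuantumAction.weight (hd : d.IsQuantumAction N Z) (γ : Γ) (k : Fin n → ℤ) : Fin n → ℤ :=
  (d.A γ).1 *ᵥ k + (hd.bohrSommerfeld γ).choose

/-! ### Transport of modes and the terms of the theta series -/

namespace IsQuantumAction

variable (hd : d.IsQuantumAction N Z)

include hd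

theorem rhoT_invT (γ : Γ) (q : Cov n) : d.rhoT γ (d.invT γ q) = q := by
  refine Prod.ext (hd.rho_rho_inv γ q.1) ?_
  simp only [rhoT, invT, Matrix.mulVec_mulVec, d.AinvT_mul_AR_transpose, Matrix.one_mulVec,
    sub_add_cancel]

theorem invT_rhoT (γ : Γ) (p : Cov n) : d.invT γ (d.rhoT γ p) = p := by
  refine Prod.ext (hd.rho_inv_rho γ p.1) ?_
  simp only [rhoT, invT, hd.rho_inv_rho, add_sub_cancel_right, Matrix.mulVec_mulVec,
    d.AR_transpose_mul_AinvT, Matrix.one_mulVec]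

theorem transport_rhoT (γ : Γ) (f : Cov n → ℂ) (p : Cov n) :
    d.transport N γ f (d.rhoT γ p) = d.factor N γ p * f p := by
  rw [transport, hd.invT_rhoT]

theorem eq_transport {γ : Γ} {f g : Cov n → ℂ}
    (h : ∀ p, g (d.rhoT γ p) = d.factor N γ p * f p) : g = d.transport N γ f := by
  funext q
  rw [← hd.rhoT_invT γ q, h, hd.transport_rhoT]

theorem transport_of_isEquivariant {s : Cov n → ℂ} (hs : d.IsEquivariant N s) (γ : Γ) :
    d.transport N γ s = s :=
  (hd.eq_transport fun p => (hs γ p).symm).symm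

theorem bsPoint_weight (γ : Γ) (k : Fin n → ℤ) :
    bsPoint N (hd.weight γ k) = d.rho γ (bsPoint N k) := by
  have hc := (hd.bohrSommerfeld γ).choose_spec
  rw [rho]
  conv_rhs => rw [hc]
  ext i
  simp only [bsPoint, weight, Pi.add_apply, Matrix.mulVec, dotProduct, AR, Matrix.map_apply]
  push_cast
  rw [add_div, Finset.sum_div]
  congr 1
  exact Finset.sum_congr rfl fun j _ => by ring

theorem differentiable_invT (γ : Γ) : Differentiable ℝ (d.invT γ) := by
  have h1 : Differentiable ℝ (d.rho γ⁻¹) := fun x =>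
    ((Matrix.mulVecLin (d.AR γ⁻¹)).toContinuousLinearMap.hasFDerivAt.add_const
      (d.c γ⁻¹)).differentiableAt
  have h2 : Differentiable ℝ fun q : Cov n => d.rho γ⁻¹ q.1 := h1.comp differentiable_fst
  refine h2.prodMk ?_
  exact (Matrix.mulVecLin (d.AR γ)ᵀ).toContinuousLinearMap.differentiable.comp
    (differentiable_snd.sub ((hd.differentiable_u γ).comp h2))

theorem differentiable_factor (γ : Γ) : Differentiable ℝ (d.factor N γ) := fun p =>
  (hd.hasFDerivAt_factor γ p).choose_spec.1.differentiableAt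

theorem differentiable_transport (γ : Γ) {f : Cov n → ℂ} (hf : Differentiable ℝ f) :
    Differentiable ℝ (d.transport N γ f) :=
  ((hd.differentiable_factor γ).comp (hd.differentiable_invT γ)).mul
    (hf.comp (hd.differentiable_invT γ))

theorem fderiv_transport (γ : Γ) {f : Cov n → ℂ} (hf : Differentiable ℝ f) (p v : Cov n) :
    fderiv ℝ (d.transport N γ f) (d.rhoT γ p) (d.rhoTDeriv γ p v)
      = d.factor N γ p * (fderiv ℝ f p v + 2 * Real.pi * Complex.I * N *
        ((d.rho γ p.1 ⬝ᵥ fderiv ℝ (d.u γ) p.1 v.1 + d.c γ ⬝ᵥ d.AinvT γ *ᵥ v.2 : ℝ) : ℂ) * f p) := by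
  obtain ⟨L, hL, hL'⟩ := hd.hasFDerivAt_factor γ p
  have h1 := (hd.differentiable_transport γ hf (d.rhoT γ p)).hasFDerivAt.comp p
    (hd.hasFDerivAt_rhoT γ p)
  have h2 := hL.mul (hf p).hasFDerivAt
  have e : d.transport N γ f ∘ d.rhoT γ = d.factor N γ * f := funext (hd.transport_rhoT γ f)
  rw [e] at h1
  have h3 := congrArg (fun L : Cov n →L[ℝ] ℂ => L v) (h1.unique h2)
  simp only [ContinuousLinearMap.comp_apply, add_apply, smul_apply, smul_eq_mul, hL'] at h3
  rw [h3]
  ring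

/-- The pullback of `x·dy` by `ρ̃_γ` exceeds `x·dy` by `ρ_γ·du_γ + c_γ·ᵗA_γ⁻¹dy`, which is what the
logarithmic derivative of the factor compensates. -/
theorem nabla_transport (γ : Γ) {f : Cov n → ℂ} (hf : Differentiable ℝ f) (p v : Cov n) :
    nabla N (d.transport N γ f) (d.rhoT γ p) (d.rhoTDeriv γ p v)
      = d.factor N γ p * nabla N f p v := by
  rw [nabla, hd.fderiv_transport γ hf, hd.transport_rhoT, nabla]
  have h1 : (d.rhoT γ p).1 ⬝ᵥ (d.rhoTDeriv γ p v).2 = p.1 ⬝ᵥ v.2 + d.c γ ⬝ᵥ d.AinvT γ *ᵥ v.2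
      + d.rho γ p.1 ⬝ᵥ fderiv ℝ (d.u γ) p.1 v.1 := by
    rw [rhoTDeriv_apply, dotProduct_add, ← d.rho_dotProduct]
    rfl
  rw [h1]
  push_cast
  ring

theorem isMode_transport (γ : Γ) {k : Fin n → ℤ} {f : Cov n → ℂ} (hf : IsMode N Z k f) (hN : 0 < N) :
    IsMode N Z (hd.weight γ k) (d.transport N γ f) := by
  obtain ⟨hdf, hol, hy⟩ := isMode_iff.1 hf
  refine isMode_iff.2 ⟨hd.differentiable_transport γ hdf, fun q w => ?_, fun q i => ?_⟩
  · obtain ⟨p, rfl⟩ : ∃ p, d.rhoT γ p = q := ⟨_, hd.rhoT_invT γ q⟩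
    obtain ⟨v, rfl⟩ := d.rhoTDeriv_surjective γ p w
    have h1 : cplxJ (Z (d.rhoT γ p).1) (d.rhoTDeriv γ p v)
        = d.rhoTDeriv γ p (cplxJ (Z p.1) v) := by
      have := hd.complex γ p v
      rw [(hd.hasFDerivAt_rhoT γ p).fderiv] at this
      exact this.symm
    rw [h1, hd.nabla_transport γ hdf, hd.nabla_transport γ hdf]
    linear_combination d.factor N γ p * hol p v
  · obtain ⟨p, rfl⟩ : ∃ p, d.rhoT γ p = q := ⟨_, hd.rhoT_invT γ q⟩
    -- Fibre directions go to fibre directions, so the new weight is `A_γ k` plus the shift `N c_γ`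
    -- coming from the factor.
    have h1 : (ddy i : Cov n) = d.rhoTDeriv γ p (0, (d.AR γ)ᵀ *ᵥ Pi.single i 1) := by
      rw [rhoTDeriv_apply]
      simp only [Matrix.mulVec_zero, map_zero, add_zero, Matrix.mulVec_mulVec,
        d.AinvT_mul_AR_transpose, Matrix.one_mulVec]
      rfl
    rw [h1, hd.fderiv_transport γ hdf, hd.transport_rhoT, (hf p).fderiv, smul_apply,
      modeForm_apply]
    simp only [map_zero, dotProduct_zero, zero_add, Matrix.mulVec_mulVec,
      d.AinvT_mul_AR_transpose, Matrix.one_mulVec, dotProduct_single_one, Pi.zero_apply,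
      Complex.ofReal_zero, mul_zero, sub_zero, smul_eq_mul]
    have h2 : (N : ℂ) * (d.c γ i : ℂ) = ((hd.bohrSommerfeld γ).choose i : ℂ) := by
      have hN' : (N : ℂ) ≠ 0 := by exact_mod_cast hN.ne'
      conv_lhs => rw [(hd.bohrSommerfeld γ).choose_spec]
      simp only [bsPoint]
      push_cast
      field_simp
    have h3 : (hd.weight γ k i : ℂ) = ∑ j, (k j : ℂ) * ((((d.AR γ)ᵀ *ᵥ Pi.single i 1) j : ℝ) : ℂ)
        + N * d.c γ i := by
      have h4 : ∀ j, ((d.AR γ)ᵀ *ᵥ Pi.single i 1) j = ((d.A γ).1 i j : ℝ) := fun j => by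
        rw [Matrix.mulVec_single_one]
        rfl
      rw [h2, weight]
      simp only [h4]
      simp [Matrix.mulVec, dotProduct, mul_comm]
    rw [h3]
    ring

theorem thetaTerm_eq (m : Fin n → ℤ) (γ : Γ) (hN : 0 < N) :
    d.thetaTerm N Z m γ = d.transport N γ (baseMode N Z m) := by
  refine hd.eq_transport fun p => ?_
  have hN' : (N : ℂ) ≠ 0 := by exact_mod_cast hN.ne'
  have h1 : (d.rhoT γ p).1 = d.rho γ p.1 := rfl
  have h2 : (d.rhoT γ p).2 = d.AinvT γ *ᵥ p.2 + d.u γ p.1 := rfl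
  have h3 : ∑ j, (m j : ℂ) * (p.2 j : ℂ) = N * ((bsPoint N m ⬝ᵥ p.2 : ℝ) : ℂ) := by
    simp only [bsPoint, dotProduct]
    push_cast
    rw [Finset.mul_sum]
    refine Finset.sum_congr rfl fun j _ => ?_
    field_simp
  rw [thetaTerm, aTrans, h1, h2, hd.rho_inv_rho, factor, baseMode, h3, dotProduct_add,
    d.rho_dotProduct]
  have h4 : ∀ g a e₁ e₂ e₃ e₄ : ℂ, e₁ + e₂ = e₃ + e₄ →
      g * a * Complex.exp e₁ * Complex.exp e₂ = g * Complex.exp e₃ * (a * Complex.exp e₄) := by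
    intro g a e₁ e₂ e₃ e₄ h
    calc _ = g * a * Complex.exp (e₁ + e₂) := by rw [Complex.exp_add]; ring
      _ = _ := by rw [h, Complex.exp_add]; ring
  apply h4
  push_cast
  ring

theorem isMode_thetaTerm (hZ : SmoothSiegel Z) (hN : 0 < N) {m : Fin n → ℤ}
    (hm : Commutativity N Z m) (γ : Γ) :
    IsMode N Z (hd.weight γ m) (d.thetaTerm N Z m γ) := by
  rw [hd.thetaTerm_eq m γ hN]
  exact hd.isMode_transport γ (isMode_baseMode hZ hm) hN

theorem thetaTerm_periodic (hN : 0 < N) (m : Fin n → ℤ) (γ : Γ) :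
    PeriodicInFibre (d.thetaTerm N Z m γ) := by
  intro p k
  rw [thetaTerm, thetaTerm, dotProduct_add, ← hd.bsPoint_weight]
  have hN' : (N : ℂ) ≠ 0 := by exact_mod_cast hN.ne'
  have : 2 * Real.pi * Complex.I * N * ((bsPoint N (hd.weight γ m) ⬝ᵥ intVec k : ℝ) : ℂ)
      = ((∑ j, hd.weight γ m j * k j : ℤ) : ℂ) * (2 * Real.pi * Complex.I) := by
    simp only [bsPoint, dotProduct, intVec]
    push_cast
    rw [Finset.mul_sum, Finset.sum_mul]
    refine Finset.sum_congr rfl fun j _ => ?_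
    field_simp
  rw [Complex.ofReal_add, mul_add, Complex.exp_add, this, Complex.exp_int_mul_two_pi_mul_I, mul_one]

/-- The cocycle rule of the factors. The action law for `ρ̃` holds only modulo `ℤⁿ`, and periodicity
of the terms absorbs the difference. -/
theorem thetaTerm_mul_rhoT (hN : 0 < N) (m : Fin n → ℤ) (γ' γ : Γ) (p : Cov n) :
    d.thetaTerm N Z m (γ' * γ) (d.rhoT γ' p)
      = d.factor N γ' p * d.thetaTerm N Z m γ p := by
  obtain ⟨q, rfl⟩ : ∃ q, d.rhoT γ q = p := ⟨_, hd.rhoT_invT γ p⟩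
  obtain ⟨h1, k, h2⟩ := hd.mul_act γ' γ q
  have h3 : d.rhoT γ' (d.rhoT γ q)
      = ((d.rhoT (γ' * γ) q).1, (d.rhoT (γ' * γ) q).2 + intVec k) := Prod.ext h1 h2
  rw [h3, hd.thetaTerm_periodic hN, hd.thetaTerm_eq _ _ hN, hd.thetaTerm_eq _ _ hN,
    hd.transport_rhoT, hd.transport_rhoT, hd.factor_mul, mul_assoc]

theorem isEquivariant_theta (hN : 0 < N) (m : Fin n → ℤ) :
    d.IsEquivariant N (d.theta N Z m) := by
  intro γ p
  -- Reindexing and multiplication by a constant are valid for `tsum` over a field without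
  -- convergence.
  rw [theta, theta, ← tsum_mul_left, ← (Equiv.mulLeft γ).tsum_eq fun γ' => d.thetaTerm N Z m γ' _]
  exact tsum_congr fun γ' => (hd.thetaTerm_mul_rhoT hN m γ γ' p).symm

theorem weight_injective (hfree : d.IsFree) (k : Fin n → ℤ) :
    Function.Injective fun γ => hd.weight γ k := by
  intro γ γ' h
  have h1 := congrArg (bsPoint N) h
  simp only [hd.bsPoint_weight] at h1
  have h2 := hfree (γ⁻¹ * γ') (bsPoint N k) (by rw [hd.rho_mul, ← h1, hd.rho_inv_rho])
  exact (inv_mul_eq_one.1 h2)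

end IsQuantumAction

end ActionData

/-! ### Integrability -/

theorem lieBracket_const_prod {n : ℕ} (a b : Fin n → ℝ) {φ ψ : (Fin n → ℝ) → Fin n → ℝ}
    (hφ : Differentiable ℝ φ) (hψ : Differentiable ℝ ψ) (p : Cov n) :
    VectorField.lieBracket ℝ (fun q : Cov n => ((a, φ q.1) : Cov n))
        (fun q : Cov n => ((b, ψ q.1) : Cov n)) p
      = (0, fderiv ℝ ψ p.1 a - fderiv ℝ φ p.1 b) := by
  have h : ∀ (a : Fin n → ℝ) {φ : (Fin n → ℝ) → Fin n → ℝ}, Differentiable ℝ φ →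
      HasFDerivAt (fun q : Cov n => ((a, φ q.1) : Cov n))
        ((0 : Cov n →L[ℝ] Fin n → ℝ).prod
          (fderiv ℝ φ p.1 ∘L ContinuousLinearMap.fst ℝ _ _)) p := fun a φ hφ =>
    (hasFDerivAt_const a p).prodMk (HasFDerivAt.comp p (hφ p.1).hasFDerivAt hasFDerivAt_fst)
  rw [VectorField.lieBracket, (h a hφ).fderiv, (h b hψ).fderiv]
  simp

/-- The Nijenhuis tensor is tested on the fields `(eᵢ, Re Ω eᵢ)`, whose images under `J` are the
vertical fields `(0, Im Ω eᵢ)`. All brackets are vertical, and the equation becomes `J(0, w) = (0,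
z)` with `w`, `z` the defects of symmetry of the derivatives of `Im Ω`, `Re Ω`. As `J(0, w)` has
base part `-W w` and `W` is invertible, both vanish. -/
theorem IsIntegrable.fderiv_OmegaM_symm {n : ℕ} {Z : (Fin n → ℝ) → Siegel n} (hZ : SmoothSiegel Z)
    (hI : IsIntegrable Z) (i j k : Fin n) (x : Fin n → ℝ) :
    fderiv ℝ (fun x => OmegaM (Z x) j k) x (Pi.single i 1)
      = fderiv ℝ (fun x => OmegaM (Z x) i k) x (Pi.single j 1) := by
  set r : Fin n → (Fin n → ℝ) → Fin n → ℝ := fun i x => omRe (Z x) *ᵥ Pi.single i 1 with hr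
  set t : Fin n → (Fin n → ℝ) → Fin n → ℝ := fun i x => omIm (Z x) *ᵥ Pi.single i 1 with ht
  have hrk : ∀ i k, (fun x => r i x k) = fun x => omRe (Z x) k i := by
    intro i k
    funext x
    simp only [hr, Matrix.mulVec_single_one]
    rfl
  have htk : ∀ i k, (fun x => t i x k) = fun x => omIm (Z x) k i := by
    intro i k
    funext x
    simp only [ht, Matrix.mulVec_single_one]
    rfl
  have hrs : ∀ i, ContDiff ℝ ∞ (r i) := fun i => contDiff_pi.2 fun k => by
    rw [hrk]; exact contDiff_omRe hZ k i
  have hts : ∀ i, ContDiff ℝ ∞ (t i) := fun i => contDiff_pi.2 fun k => by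
    rw [htk]; exact contDiff_omIm hZ k i
  have hrd : ∀ i, Differentiable ℝ (r i) := fun i => (hrs i).differentiable (by simp)
  have htd : ∀ i, Differentiable ℝ (t i) := fun i => (hts i).differentiable (by simp)
  have hU : ∀ i, ContDiff ℝ ∞ fun q : Cov n => ((Pi.single i 1, r i q.1) : Cov n) := fun i =>
    contDiff_const.prodMk ((hrs i).comp contDiff_fst)
  have h := hI (fun q => (Pi.single i 1, r i q.1)) (fun q => (Pi.single j 1, r j q.1))
    (hU i) (fun _ _ => rfl) (hU j) (fun _ _ => rfl) (x, 0)
  have hJ : ∀ (i : Fin n) (q : Cov n), cplxJ (Z q.1) (Pi.single i 1, r i q.1) = (0, t i q.1) :=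
    fun i q => cplxJ_omRe (Z q.1) _
  simp only [hJ] at h
  rw [lieBracket_const_prod _ _ (htd i) (htd j), lieBracket_const_prod _ _ (htd i) (hrd j),
    lieBracket_const_prod _ _ (hrd i) (htd j), lieBracket_const_prod _ _ (hrd i) (hrd j),
    sub_sub (_ - _), sub_sub] at h
  simp only [map_zero, sub_zero, zero_sub] at h
  set w := fderiv ℝ (t i) x (Pi.single j 1) - fderiv ℝ (t j) x (Pi.single i 1) with hw
  set z := fderiv ℝ (r j) x (Pi.single i 1) - fderiv ℝ (r i) x (Pi.single j 1) with hz
  have h1 : cplxJ (Z x) (0, w) = (0, z) := by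
    have e : ((0, w) : Cov n) = -(0, -fderiv ℝ (t i) x (Pi.single j 1))
        - (0, fderiv ℝ (t j) x (Pi.single i 1)) := by
      simp [hw]
    rw [e, map_sub, map_neg, ← sub_eq_zero, ← h]
    have e0 : ((0, 0) : Cov n) = 0 := rfl
    rw [e0]
    abel
  have hw0 : w = 0 := by
    have h2 := congrArg Prod.fst h1
    simp only [cplxJ_apply, Matrix.mulVec_zero, zero_sub, neg_eq_zero] at h2
    have h3 := congrArg (fun v => (wM (Z x))⁻¹ *ᵥ v) h2
    simpa [Matrix.mulVec_mulVec, Matrix.nonsing_inv_mul _ (wM_det (Z x))] using h3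
  have hz0 : z = 0 := by
    rw [hw0] at h1
    have e0 : ((0, 0) : Cov n) = 0 := rfl
    rw [e0, map_zero] at h1
    exact (congrArg Prod.snd h1).symm
  have hd : ∀ i j, fderiv ℝ (fun x => OmegaM (Z x) i k) x (Pi.single j 1)
      = ((fderiv ℝ (r i) x (Pi.single j 1) k : ℝ) : ℂ)
        + Complex.I * ((fderiv ℝ (t i) x (Pi.single j 1) k : ℝ) : ℂ) := by
    intro i j
    have e : (fun x => OmegaM (Z x) i k) = fun x => ((r i x k : ℝ) : ℂ)
        + Complex.I * ((t i x k : ℝ) : ℂ) := by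
      funext x
      rw [OmegaM_symm, OmegaM_apply, congrFun (hrk i k) x, congrFun (htk i k) x]
    have hof : ∀ {φ : (Fin n → ℝ) → Fin n → ℝ}, Differentiable ℝ φ →
        HasFDerivAt (fun x => ((φ x k : ℝ) : ℂ)) (Complex.ofRealCLM ∘L
          ContinuousLinearMap.proj (R := ℝ) (φ := fun _ : Fin n => ℝ) k ∘L fderiv ℝ φ x) x :=
      fun hφ => (Complex.ofRealCLM ∘L ContinuousLinearMap.proj (R := ℝ) (φ := fun _ : Fin n => ℝ)
        k).hasFDerivAt.comp x (hφ x).hasFDerivAt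
    rw [e, ((hof (hrd i)).fun_add ((hof (htd i)).const_mul Complex.I)).fderiv]
    simp
  rw [hd, hd, sub_eq_zero.1 hz0, sub_eq_zero.1 hw0]

theorem IsIntegrable.commutativity {n : ℕ} {Z : (Fin n → ℝ) → Siegel n} (hZ : SmoothSiegel Z)
    (hI : IsIntegrable Z) (N : ℕ) (m : Fin n → ℤ) : Commutativity N Z m := fun i j x =>
  Finset.sum_congr rfl fun k _ => by rw [hI.fderiv_OmegaM_symm hZ i j k x]

/-! ### Convergence of series -/

theorem convergesAbsUnif_of_bound {n : ℕ} {ι : Type*} {f : ι → Cov n → ℂ}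
    (h : ∀ R : ℝ, ∃ u : ι → ℝ, Summable u ∧ ∀ i, ∀ p ∈ Metric.closedBall (0 : Cov n) R,
      ‖f i p‖ ≤ u i) : ConvergesAbsUnif f := by
  refine ⟨fun p => ?_, fun K hK => ?_⟩
  · obtain ⟨u, hu, hub⟩ := h ‖p‖
    exact .of_nonneg_of_le (fun _ => norm_nonneg _) (fun i => hub i p (by simp)) hu
  · obtain ⟨R, hR⟩ := hK.isBounded.subset_closedBall (0 : Cov n)
    obtain ⟨u, hu, hub⟩ := h R
    exact tendstoUniformlyOn_tsum hu fun i p hp => hub i p (hR hp)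

theorem convergesAbsUnif_of_support_subset {n : ℕ} {ι : Type*} {f : ι → Cov n → ℂ}
    (S : Finset ι) (hf : ∀ p, ∀ i ∉ S, f i p = 0) : ConvergesAbsUnif f := by
  refine ⟨fun p => summable_of_ne_finset_zero (s := S) fun i hi => by rw [hf p i hi, norm_zero],
    fun K _ => Metric.tendstoUniformlyOn_iff.2 fun ε hε => ?_⟩
  filter_upwards [Filter.eventually_ge_atTop S] with T hT p _
  rw [tsum_eq_sum (s := T) fun i hi => hf p i fun h => hi (hT h), dist_self]
  exact hε

namespace IsModeFamily

variable {n N : ℕ} {ι : Type*} {Z : (Fin n → ℝ) → Siegel n} {wt : ι → Fin n → ℤ}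
  {f : ι → Cov n → ℂ}

theorem convergesAbsUnif (hZ : SmoothSiegel Z) (hf : IsModeFamily N Z wt f) :
    ConvergesAbsUnif f := by
  refine convergesAbsUnif_of_bound fun R => ?_
  obtain ⟨u, hu, h⟩ := hf.exists_summable_bound hZ R 0
  exact ⟨u, hu, fun i p hp => by simpa using h i p hp⟩

end IsModeFamily

theorem hasSum_component_modes {n N : ℕ} {ι : Type*} {Z : (Fin n → ℝ) → Siegel n}
    {wt : ι → Fin n → ℤ} {f : ι → Cov n → ℂ} (hZ : SmoothSiegel Z)
    (hf : ∀ i, IsMode N Z (wt i) (f i)) (hc : ConvergesAbsUnif f) (k : Fin n → ℤ) (p : Cov n) :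
    HasSum (fun i => if k = wt i then f i p else 0) (component k (fun p => ∑' i, f i p) p) := by
  have := hasSum_component_of_tendstoUniformlyOn
    (fun i => ((hf i).contDiff hZ).continuous) hc.2 k p
  simpa only [component_of_isMode hZ (hf _)] using this

/-- Fibre integration commutes with locally uniform limits, and distinct weights leave only one
term. -/
theorem component_tsum {n N : ℕ} {ι : Type*} {Z : (Fin n → ℝ) → Siegel n}
    {wt : ι → Fin n → ℤ} {f : ι → Cov n → ℂ} (hZ : SmoothSiegel Z)
    (hwt : Function.Injective wt) (hf : ∀ i, IsMode N Z (wt i) (f i)) (hc : ConvergesAbsUnif f)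
    (i : ι) (p : Cov n) : component (wt i) (fun p => ∑' i, f i p) p = f i p := by
  refine (hasSum_component_modes hZ hf hc (wt i) p).unique ?_
  convert! hasSum_single i fun j hj => if_neg (hwt.ne hj.symm)
  simp

/-- A locally uniformly convergent series of modes with pairwise different weights is locally
uniformly bounded. -/
theorem isModeFamily_of_convergesAbsUnif {n N : ℕ} {ι : Type*} {Z : (Fin n → ℝ) → Siegel n}
    {wt : ι → Fin n → ℤ} {f : ι → Cov n → ℂ} (hZ : SmoothSiegel Z)
    (hwt : Function.Injective wt) (hf : ∀ i, IsMode N Z (wt i) (f i)) (hc : ConvergesAbsUnif f) :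
    IsModeFamily N Z wt f := by
  refine ⟨hwt, hf, fun R => ?_⟩
  have hK := isCompact_closedBall (0 : Cov n) (R + 1)
  have hcont : ContinuousOn (fun p => ∑' i, f i p) (Metric.closedBall (0 : Cov n) (R + 1)) :=
    (hc.2 _ hK).continuousOn (.of_forall fun S =>
      (continuous_finsetSum S fun i _ => ((hf i).contDiff hZ).continuous).continuousOn)
  obtain ⟨B, hB⟩ := hK.exists_bound_of_continuousOn hcont
  refine ⟨B, fun i p hp => ?_⟩
  -- Each term is a Fourier component of the sum, so it is bounded by the maximum of the sum on a
  -- slightly larger ball.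
  rw [← component_tsum hZ hwt hf hc i p]
  refine norm_component_le _ fun h hh => hB _ ?_
  rw [mem_closedBall_zero_iff] at hp ⊢
  linarith [norm_add_le p (0, h), norm_le_of_mem_Icc hh]

theorem hasSum_component_of_isHolomorphic {n N : ℕ} {Z : (Fin n → ℝ) → Siegel n} {s : Cov n → ℂ}
    (hZ : SmoothSiegel Z) (hs : IsSection s) (hol : IsHolomorphic N Z s) (p : Cov n) :
    HasSum (fun k => component k s p) (s p) :=
  hasSum_component hs.1.continuous hs.2 p ((isModeFamily_component hs hol).summable hZ p)

theorem component_const_mul {n : ℕ} (k : Fin n → ℤ) (c : ℂ) (s : Cov n → ℂ) (p : Cov n) :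
    component k (fun q => c * s q) p = c * component k s p := by
  rw [component, component, ← MeasureTheory.integral_const_mul]
  simp only [mul_left_comm]

/-! ### Equivariant holomorphic sections -/

namespace ActionData.IsQuantumAction

variable {n N : ℕ} {Γ : Type*} [Group Γ] {Z : (Fin n → ℝ) → Siegel n} {d : ActionData n Γ}
  (hd : d.IsQuantumAction N Z)

include hd

theorem weight_one (hN : 0 < N) (k : Fin n → ℤ) : hd.weight 1 k = k :=
  bsPoint_injective hN (by rw [hd.bsPoint_weight, hd.rho_one])

theorem weight_inv_weight (hN : 0 < N) (γ : Γ) (k : Fin n → ℤ) :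
    hd.weight γ⁻¹ (hd.weight γ k) = k :=
  bsPoint_injective hN (by rw [hd.bsPoint_weight, hd.bsPoint_weight, hd.rho_inv_rho])

theorem weight_weight_inv (hN : 0 < N) (γ : Γ) (k : Fin n → ℤ) :
    hd.weight γ (hd.weight γ⁻¹ k) = k :=
  bsPoint_injective hN (by rw [hd.bsPoint_weight, hd.bsPoint_weight, hd.rho_rho_inv])

/-- Each orbit of points `k/N` meets `F` exactly once, and freeness makes the group element unique.
-/
theorem weight_bijective (hN : 0 < N) (hfree : d.IsFree) {F : Set (Fin n → ℝ)}
    (hF : d.IsFundamentalDomain F) :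
    Function.Bijective fun q : BSIndex N F × Γ => hd.weight q.2 q.1.1 := by
  constructor
  · rintro ⟨m, γ⟩ ⟨m', γ'⟩ h
    have h1 := congrArg (bsPoint N) h
    simp only [hd.bsPoint_weight] at h1
    have h2 := (hF (d.rho γ (bsPoint N m.1))).unique ⟨m.2, γ, rfl⟩ ⟨m'.2, γ', h1.symm⟩
    obtain rfl : m = m' := Subtype.ext (bsPoint_injective hN h2)
    have h3 : γ = γ' := hd.weight_injective hfree m.1 h
    rw [h3]
  · intro k
    obtain ⟨z, ⟨hz, γ, hγ⟩, -⟩ := hF (bsPoint N k)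
    have h1 : bsPoint N (hd.weight γ⁻¹ k) = z := by
      rw [hd.bsPoint_weight, ← hγ, hd.rho_inv_rho]
    exact ⟨(⟨hd.weight γ⁻¹ k, by rwa [h1]⟩, γ), hd.weight_weight_inv hN γ k⟩

/-- The orbit decomposition of the set of weights. -/
def weightEquiv (hN : 0 < N) (hfree : d.IsFree) {F : Set (Fin n → ℝ)}
    (hF : d.IsFundamentalDomain F) : BSIndex N F × Γ ≃ (Fin n → ℤ) :=
  Equiv.ofBijective _ (hd.weight_bijective hN hfree hF)

theorem weight_eq_iff (hN : 0 < N) (hfree : d.IsFree) {F : Set (Fin n → ℝ)}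
    (hF : d.IsFundamentalDomain F) (m m' : BSIndex N F) (γ : Γ) :
    m'.1 = hd.weight γ m.1 ↔ m' = m ∧ γ = 1 := by
  constructor
  · intro h
    have := (hd.weight_bijective hN hfree hF).1 (a₁ := (m', 1)) (a₂ := (m, γ))
      ((hd.weight_one hN _).trans h)
    rw [Prod.mk.injEq] at this
    exact ⟨this.1, this.2.symm⟩
  · rintro ⟨rfl, rfl⟩
    exact (hd.weight_one hN _).symm

/-- A non-zero section has a non-zero Fourier component. Its weight may lie outside `N F`;
transporting the component by `γ⁻¹` gives a non-zero mode whose weight lies over `F`. -/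
theorem exists_commutativity (hZ : SmoothSiegel Z) (hN : 0 < N) {F : Set (Fin n → ℝ)}
    (hfree : d.IsFree) (hF : d.IsFundamentalDomain F) {s : Cov n → ℂ} (hs : IsSection s)
    (hol : IsHolomorphic N Z s) (hs0 : s ≠ 0) :
    ∃ m : Fin n → ℤ, bsPoint N m ∈ F ∧ Commutativity N Z m := by
  obtain ⟨p, hp⟩ := Function.ne_iff.1 hs0
  obtain ⟨k, hk⟩ : ∃ k, component k s p ≠ 0 := by
    by_contra! h
    refine hp ((hasSum_component_of_isHolomorphic hZ hs hol p).unique ?_)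
    simp [h]
  obtain ⟨⟨m, γ⟩, rfl⟩ := (hd.weight_bijective hN hfree hF).2 k
  refine ⟨m.1, m.2, ?_⟩
  have hm := hd.isMode_transport γ⁻¹ (isMode_component hs hol (hd.weight γ m.1)) hN
  rw [hd.weight_inv_weight hN] at hm
  refine hm.commutativity hZ (p₀ := d.rhoT γ⁻¹ p) ?_
  rw [hd.transport_rhoT]
  exact mul_ne_zero (d.factor_ne_zero _ _ _) hk

theorem isModeFamily_thetaTerm (hZ : SmoothSiegel Z) (hN : 0 < N) (hfree : d.IsFree)
    {m : Fin n → ℤ} (hm : Commutativity N Z m) (hc : ConvergesAbsUnif (d.thetaTerm N Z m)) :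
    IsModeFamily N Z (fun γ => hd.weight γ m) (d.thetaTerm N Z m) :=
  isModeFamily_of_convergesAbsUnif hZ (hd.weight_injective hfree m)
    (hd.isMode_thetaTerm hZ hN hm) hc

theorem thetaTerm_ne_zero (hN : 0 < N) (m : Fin n → ℤ) (γ : Γ) (p : Cov n) :
    d.thetaTerm N Z m γ p ≠ 0 := by
  rw [hd.thetaTerm_eq m γ hN]
  exact mul_ne_zero (d.factor_ne_zero _ _ _) (baseMode_ne_zero _ _ _ _)

/-- Among weights lying over `F`, only `m` itself occurs in `ϑ_{m/N}`, and only for `γ = 1`. The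
theta functions are thus separated by these components. -/
theorem component_theta (hZ : SmoothSiegel Z) (hN : 0 < N) (hfree : d.IsFree)
    {F : Set (Fin n → ℝ)} (hF : d.IsFundamentalDomain F) {m : BSIndex N F}
    (hm : Commutativity N Z m.1) (hc : ConvergesAbsUnif (d.thetaTerm N Z m.1))
    (m' : BSIndex N F) (p : Cov n) : component m'.1 (d.theta N Z m.1) p
      = if m' = m then d.thetaTerm N Z m.1 1 p else 0 := by
  classical
  have h := hasSum_component_modes hZ (hd.isMode_thetaTerm hZ hN hm) hc m'.1 p
  refine h.unique ?_
  simp only [hd.weight_eq_iff hN hfree hF]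
  by_cases hmm : m' = m
  · simp only [hmm, true_and, if_true]
    convert! hasSum_single (1 : Γ) fun γ hγ => if_neg hγ
    simp
  · simp only [hmm, false_and, if_false]
    exact hasSum_zero

theorem theta_ne_zero (hZ : SmoothSiegel Z) (hN : 0 < N) (hfree : d.IsFree)
    {F : Set (Fin n → ℝ)} (hF : d.IsFundamentalDomain F) {m : BSIndex N F}
    (hm : Commutativity N Z m.1) (hc : ConvergesAbsUnif (d.thetaTerm N Z m.1)) :
    d.theta N Z m.1 ≠ 0 := by
  intro h
  have h1 := hd.component_theta hZ hN hfree hF hm hc m 0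
  rw [h, if_pos rfl] at h1
  refine hd.thetaTerm_ne_zero hN m.1 1 0 (h1.symm.trans ?_)
  simp [component]

theorem coeff_eq_of_tsum_eq (hZ : SmoothSiegel Z) (hN : 0 < N) (hfree : d.IsFree)
    {F : Set (Fin n → ℝ)} (hF : d.IsFundamentalDomain F)
    (hm : ∀ m : BSIndex N F, Commutativity N Z m.1)
    (hc : ∀ m : BSIndex N F, ConvergesAbsUnif (d.thetaTerm N Z m.1)) {a : BSIndex N F → ℂ}
    (ha : ConvergesAbsUnif fun (m : BSIndex N F) p => a m * d.theta N Z m.1 p) (m : BSIndex N F)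
    (p : Cov n) : component m.1 (fun p => ∑' m : BSIndex N F, a m * d.theta N Z m.1 p) p
      = a m * d.thetaTerm N Z m.1 1 p := by
  have hcont : ∀ m' : BSIndex N F, Continuous (d.theta N Z m'.1) := fun m' =>
    ((hd.isModeFamily_thetaTerm hZ hN hfree (hm m') (hc m')).contDiff_tsum hZ).continuous
  have h := hasSum_component_of_tendstoUniformlyOn
    (f := fun (m' : BSIndex N F) p => a m' * d.theta N Z m'.1 p)
    (fun m' => continuous_const.mul (hcont m')) ha.2 m.1 p
  refine h.unique ?_
  simp only [component_const_mul, hd.component_theta hZ hN hfree hF (hm _) (hc _)]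
  convert! hasSum_single m fun m' hm' => ?_
  · simp
  · rw [if_neg hm'.symm, mul_zero]

theorem isModeFamily_transport (hN : 0 < N) (γ : Γ) {ι : Type*} {wt : ι → Fin n → ℤ}
    {f : ι → Cov n → ℂ} (hf : IsModeFamily N Z wt f) :
    IsModeFamily N Z (fun i => hd.weight γ (wt i)) (fun i => d.transport N γ (f i)) where
  injective i j h := hf.injective (by
    have := congrArg (hd.weight γ⁻¹) h
    simpa only [hd.weight_inv_weight hN] using this)
  isMode i := hd.isMode_transport γ (hf.isMode i) hN
  bounded R := by
    have hK := isCompact_closedBall (0 : Cov n) R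
    have hi := (hd.differentiable_invT γ).continuous
    obtain ⟨R', hR'⟩ := (hK.image hi).isBounded.subset_closedBall (0 : Cov n)
    obtain ⟨B, hB⟩ := hf.bounded R'
    obtain ⟨C, hC⟩ := hK.exists_bound_of_continuousOn
      ((hd.differentiable_factor γ).continuous.comp hi).continuousOn
    refine ⟨C * B, fun i p hp => ?_⟩
    rw [transport, norm_mul]
    exact mul_le_mul (hC p hp) (hB i _ (hR' (Set.mem_image_of_mem _ hp))) (norm_nonneg _)
      ((norm_nonneg _).trans (hC p hp))

/-- Transporting the Fourier series of `s` by `γ` gives, by equivariance, another expansion of `s`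
into modes with distinct weights; uniqueness of components identifies the terms. -/
theorem component_weight (hZ : SmoothSiegel Z) (hN : 0 < N) {s : Cov n → ℂ} (hs : IsSection s)
    (hol : IsHolomorphic N Z s) (heq : d.IsEquivariant N s) (γ : Γ) (k : Fin n → ℤ) (p : Cov n) :
    component (hd.weight γ k) s p = d.transport N γ (component k s) p := by
  have hf := hd.isModeFamily_transport hN γ (isModeFamily_component hs hol)
  have h1 : s = fun p => ∑' k, d.transport N γ (component k s) p := by
    funext q
    conv_lhs => rw [← hd.transport_of_isEquivariant heq γ]
    simp only [transport]
    rw [tsum_mul_left, (hasSum_component_of_isHolomorphic hZ hs hol _).tsum_eq]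
  conv_lhs => rw [h1]
  exact component_tsum hZ hf.injective hf.isMode (hf.convergesAbsUnif hZ) k p

theorem exists_expansion (hZ : SmoothSiegel Z) (hN : 0 < N) (hfree : d.IsFree)
    {F : Set (Fin n → ℝ)} (hF : d.IsFundamentalDomain F)
    (hm : ∀ m : BSIndex N F, Commutativity N Z m.1)
    (hc : ∀ m : BSIndex N F, ConvergesAbsUnif (d.thetaTerm N Z m.1)) {s : Cov n → ℂ}
    (hs : IsSection s) (hol : IsHolomorphic N Z s) (heq : d.IsEquivariant N s) :
    ∃ a : BSIndex N F → ℂ,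
      ConvergesAbsUnif (fun (m : BSIndex N F) p => a m * d.theta N Z m.1 p) ∧
        ∀ p, s p = ∑' m : BSIndex N F, a m * d.theta N Z m.1 p := by
  -- Modes of weight `m` are proportional, so the ratio may be read off at any point; the
  -- denominator never vanishes.
  set a : BSIndex N F → ℂ := fun m => component m.1 s 0 / baseMode N Z m.1 0 with ha
  have hfam := isModeFamily_component hs hol
  have hterm : ∀ (m : BSIndex N F) (γ : Γ) (p : Cov n),
      component (hd.weight γ m.1) s p = a m * d.thetaTerm N Z m.1 γ p := by
    intro m γ p
    rw [hd.component_weight hZ hN hs hol heq, hd.thetaTerm_eq m.1 γ hN, transport, transport,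
      (isMode_baseMode hZ (hm m)).eq_mul hZ (isMode_component hs hol m.1)
        (baseMode_ne_zero N Z m.1 0)]
    ring
  have hfib : ∀ (m : BSIndex N F) (p : Cov n),
      HasSum (fun γ => a m * d.thetaTerm N Z m.1 γ p) (a m * d.theta N Z m.1 p) := fun m p =>
    (((hc m).1 p).of_norm.hasSum).mul_left _
  set e := hd.weightEquiv hN hfree hF
  have he : ∀ q, e q = hd.weight q.2 q.1.1 := fun _ => rfl
  refine ⟨a, convergesAbsUnif_of_bound fun R => ?_, fun p => ?_⟩
  · obtain ⟨u, hu, hub⟩ := hfam.exists_summable_bound hZ R 0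
    have hue : Summable fun q => u (e q) := hu.comp_injective e.injective
    refine ⟨fun m => ∑' γ, u (e (m, γ)), hue.prod, fun m p hp => ?_⟩
    refine (hfib m p).norm_le_of_bounded (hue.prod_factor m).hasSum fun γ => ?_
    rw [← hterm, he]
    simpa using hub (hd.weight γ m.1) p hp
  -- The Fourier series of `s` is regrouped by orbits; each orbit sums to a multiple of one theta
  -- function.
  · have h1 := (e.hasSum_iff).2 (hasSum_component_of_isHolomorphic hZ hs hol p)
    have h2 : HasSum (fun q : BSIndex N F × Γ => a q.1 * d.thetaTerm N Z q.1.1 q.2 p) (s p) := by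
      refine h1.congr_fun fun q => ?_
      exact (hterm q.1 q.2 p).symm
    exact ((h2.prod_fiberwise fun m => hfib m p).tsum_eq).symm

end ActionData.IsQuantumAction

end EquivQuant

end

theorem mainTheorem5 {n N : ℕ} (hN : 0 < N) {Γ : Type*} [Group Γ]
    (Z : (Fin n → ℝ) → Siegel n) (hZ : SmoothSiegel Z)
    (d : ActionData n Γ) (hd : d.IsQuantumAction N Z)
    (hfree : d.IsFree) (hpd : d.IsProperlyDiscontinuous)
    (F : Set (Fin n → ℝ)) (hF : d.IsFundamentalDomain F) :
    (∀ s : Cov n → ℂ, IsSection s → d.IsEquivariant N s → (∀ p, dirac hN Z s p = 0) → s ≠ 0 →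
      ∃ m : Fin n → ℤ, bsPoint N m ∈ F ∧ Commutativity N Z m) ∧
    (∀ m : Fin n → ℤ, bsPoint N m ∈ F → Commutativity N Z m →
      ConvergesAbsUnif (d.thetaTerm N Z m) →
        IsSection (d.theta N Z m) ∧ d.IsEquivariant N (d.theta N Z m) ∧
          (∀ p, dirac hN Z (d.theta N Z m) p = 0) ∧ d.theta N Z m ≠ 0) ∧
    (IsIntegrable Z →
      (∀ m : Fin n → ℤ, bsPoint N m ∈ F → ConvergesAbsUnif (d.thetaTerm N Z m)) →
        (∀ m : BSIndex N F, d.theta N Z m.1 ∈ d.holSections N Z) ∧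
        LinearIndependent ℂ (fun m : BSIndex N F => d.theta N Z m.1) ∧
        (∀ s ∈ d.holSections N Z, ∃! a : BSIndex N F → ℂ,
          ConvergesAbsUnif (fun m p => a m * d.theta N Z m.1 p) ∧
            ∀ p, s p = ∑' m, a m * d.theta N Z m.1 p) ∧
        (Finite (BSIndex N F) →
          ∃ b : Module.Basis (BSIndex N F) ℂ (d.holSections N Z),
            ∀ m, (b m : Cov n → ℂ) = d.theta N Z m.1)) := by
  have hpart : ∀ m : BSIndex N F, Commutativity N Z m.1 →
      ConvergesAbsUnif (d.thetaTerm N Z m.1) → IsSection (d.theta N Z m.1) ∧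
        d.IsEquivariant N (d.theta N Z m.1) ∧ IsHolomorphic N Z (d.theta N Z m.1) ∧
          d.theta N Z m.1 ≠ 0 := by
    intro m hm hc
    have hf := hd.isModeFamily_thetaTerm hZ hN hfree hm hc
    exact ⟨hf.isSection_tsum hZ, hd.isEquivariant_theta hN m.1, hf.isHolomorphic_tsum hZ,
      hd.theta_ne_zero hZ hN hfree hF hm hc⟩
  refine ⟨fun s hs _ hD hs0 => ?_, fun m hmF hm hc => ?_, fun hI hc => ?_⟩
  · exact hd.exists_commutativity hZ hN hfree hF hs ((dirac_eq_zero_iff hN Z s).1 hD) hs0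
  · obtain ⟨h1, h2, h3, h4⟩ := hpart ⟨m, hmF⟩ hm hc
    exact ⟨h1, h2, (dirac_eq_zero_iff hN Z _).2 h3, h4⟩
  · have hm : ∀ m : BSIndex N F, Commutativity N Z m.1 := fun m => hI.commutativity hZ N m.1
    have hc' : ∀ m : BSIndex N F, ConvergesAbsUnif (d.thetaTerm N Z m.1) := fun m => hc m.1 m.2
    have hmem : ∀ m : BSIndex N F, d.theta N Z m.1 ∈ d.holSections N Z := by
      intro m
      obtain ⟨h1, h2, h3, -⟩ := hpart m (hm m) (hc' m)
      exact ⟨h1, h3, h2⟩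
    have huniq : ∀ a b : BSIndex N F → ℂ,
        ConvergesAbsUnif (fun (m : BSIndex N F) p => a m * d.theta N Z m.1 p) →
        ConvergesAbsUnif (fun (m : BSIndex N F) p => b m * d.theta N Z m.1 p) →
        (∀ p, ∑' m : BSIndex N F, a m * d.theta N Z m.1 p
          = ∑' m : BSIndex N F, b m * d.theta N Z m.1 p) → a = b := by
      intro a b ha hb hab
      funext m
      have h1 := hd.coeff_eq_of_tsum_eq hZ hN hfree hF hm hc' ha m 0
      rw [funext hab, hd.coeff_eq_of_tsum_eq hZ hN hfree hF hm hc' hb m 0] at h1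
      exact (mul_right_cancel₀ (hd.thetaTerm_ne_zero hN m.1 1 0) h1).symm
    have hexp : ∀ s ∈ d.holSections N Z, ∃ a : BSIndex N F → ℂ,
        ConvergesAbsUnif (fun (m : BSIndex N F) p => a m * d.theta N Z m.1 p) ∧
          ∀ p, s p = ∑' m : BSIndex N F, a m * d.theta N Z m.1 p := fun s hs =>
      hd.exists_expansion hZ hN hfree hF hm hc' hs.1 hs.2.1 hs.2.2
    have hli : LinearIndependent ℂ (fun m : BSIndex N F => d.theta N Z m.1) := by
      classical
      rw [linearIndependent_iff']
      intro S g hg m hmS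
      have hsupp : ∀ (p : Cov n) (m : BSIndex N F), m ∉ S →
          (if m ∈ S then g m else 0) * d.theta N Z m.1 p = 0 := fun p m hm => by simp [hm]
      -- A finite relation is read as a convergent series with coefficients extended by zero, so
      -- uniqueness of expansions gives linear independence.
      have h1 := huniq (fun m => if m ∈ S then g m else 0) 0
        (convergesAbsUnif_of_support_subset S hsupp)
        (convergesAbsUnif_of_support_subset S (by simp)) (fun p => by
          rw [tsum_eq_sum (s := S) (hsupp p)]
          have h2 := congrFun hg p
          simp only [Finset.sum_apply, Pi.smul_apply, smul_eq_mul, Pi.zero_apply] at h2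
          simp only [Pi.zero_apply, zero_mul, tsum_zero]
          rw [← h2]
          exact Finset.sum_congr rfl fun m hm => by rw [if_pos hm])
      simpa [hmS] using congrFun h1 m
    refine ⟨hmem, hli, fun s hs => ?_, fun hfin => ?_⟩
    · obtain ⟨a, ha, has⟩ := hexp s hs
      exact ⟨a, ⟨ha, has⟩, fun b ⟨hb, hbs⟩ =>
        huniq b a hb ha fun p => (hbs p).symm.trans (has p)⟩
    · cases nonempty_fintype (BSIndex N F)
      let v : BSIndex N F → d.holSections N Z := fun m => ⟨d.theta N Z m.1, hmem m⟩
      have hv : LinearIndependent ℂ v := LinearIndependent.of_comp (d.holSections N Z).subtype hli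
      refine ⟨Module.Basis.mk hv ?_, fun m => by rw [Module.Basis.mk_apply]⟩
      rintro ⟨s, hs⟩ -
      obtain ⟨a, -, has⟩ := hexp s hs
      have : (⟨s, hs⟩ : d.holSections N Z) = ∑ m, a m • v m := by
        refine Subtype.ext (funext fun p => ?_)
        rw [AddSubmonoidClass.coe_finsetSum, Finset.sum_apply]
        exact (has p).trans (tsum_fintype _)
      rw [this]
      exact Submodule.sum_mem _ fun m _ => Submodule.smul_mem _ _ (Submodule.subset_span ⟨m, rfl⟩)
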